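/- **Superlow Basis Theorem (over a possibly nonstandard model).** Let $M$ be a model of $P^-$ (the axioms of discretely ordered commutative semirings with least element $0$ in which $x\le y$ iff $y=x+z$ for some $z$) and let $A\subseteq M$ be such that $(M,\{A\})\models \exp+\mathrm{I}\Sigma^0_1$; that is, $x\mapsto 2^x$ is total on $M$, and induction holds for every subset of $M$ that is $\Sigma_1$ definable with the set parameter $A$ and first-order parameters from $M$. Let $T$ be an infinite (that is, unbounded in $M$) binary tree that is $\Delta^A_1$ (both $T$ and its complement are $\Sigma_1$ definable with the set parameter $A$ and first-order parameters from $M$). Then $T$ contains an infinite path $P$ such that $P'\le_{wtt}T'$. Here binary strings are coded by elements of $M$ (prepend the digit $1$ and read in base two), a *binary tree* is a set of strings closed under initial segments, and a *path* is a binary tree that is totally ordered by end-extension. For $Z\subseteq M$, $(\Phi^Z_e)_{e\in M}$ is Kleene's universal enumeration, carried out inside $M$, of the partial recursive functions with oracle $Z$ (with arbitrary elements of $M$ as constants), and $\Phi^Z_{e,s}(x)\downarrow$ means that some computation of $\Phi^Z_e(x)$ has a code below $s$. The jump of $Z$ is $Z'=\{e\in M:\Phi^Z_e(e)\downarrow\}$.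 Finally $X\le_{wtt}Y$ means that there are $e\in M$ and a computable total $f:M\to M$ (its graph is $\Sigma_1$ definable with first-order parameters from $M$ and no set parameter) such that $\Phi^Y_e$ is the characteristic function of $X$ and $\Phi^Y_{e,f(x)}(x)\downarrow$ for all $x\in M$. -/

import Mathlib

namespace RevRec

/-- The axioms of `P⁻`: `M` is a discretely ordered commutative semiring with least element `0`
in which `x ≤ y` holds exactly when `y = x + z` for some `z`. -/
class PMinus (M : Type*) [CommSemiring M] [LinearOrder M] : Prop extends
    IsStrictOrderedRing M, CanonicallyOrderedAdd M where
  one_le_of_pos : ∀ x : M, 0 < x → 1 ≤ x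

/-! ### Bounded formulas and definability with a set parameter -/

/-- Terms of the language of arithmetic, with variables indexed by `ℕ`. -/
inductive ArithTerm : Type
  | var (i : ℕ) : ArithTerm
  | zero : ArithTerm
  | one : ArithTerm
  | add (s t : ArithTerm) : ArithTerm
  | mul (s t : ArithTerm) : ArithTerm

/-- The value of a term under an assignment `v`. -/
def ArithTerm.val {M : Type*} [CommSemiring M] (v : ℕ → M) : ArithTerm → M
  | .var i => v i
  | .zero => 0
  | .one => 1
  | .add s t => s.val v + t.val v
  | .mul s t => s.val v * t.val v

/-- Bounded (`Σ₀`) formulas of the language of second-order arithmetic with one free set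
variable `Z`; `mem t` is the atomic formula `t ∈ Z`. The term `t` in `ball i t φ`, that is
`(∀ xᵢ < t) φ`, and in `bex i t φ`, that is `(∃ xᵢ < t) φ`, is outside the scope of the
quantifier. -/
inductive BddFormula : Type
  | eq (s t : ArithTerm) : BddFormula
  | lt (s t : ArithTerm) : BddFormula
  | mem (t : ArithTerm) : BddFormula
  | not (φ : BddFormula) : BddFormula
  | and (φ ψ : BddFormula) : BddFormula
  | or (φ ψ : BddFormula) : BddFormula
  | ball (i : ℕ) (t : ArithTerm) (φ : BddFormula) : BddFormula
  | bex (i : ℕ) (t : ArithTerm) (φ : BddFormula) : BddFormula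

/-- Truth of a bounded formula in `(M, {A})`, the set variable being interpreted as `A`. -/
def BddFormula.Holds {M : Type*} [CommSemiring M] [LinearOrder M] (A : Set M) :
    BddFormula → (ℕ → M) → Prop
  | .eq s t, v => s.val v = t.val v
  | .lt s t, v => s.val v < t.val v
  | .mem t, v => t.val v ∈ A
  | .not φ, v => ¬ φ.Holds A v
  | .and φ ψ, v => φ.Holds A v ∧ ψ.Holds A v
  | .or φ ψ, v => φ.Holds A v ∨ ψ.Holds A v
  | .ball i t φ, v => ∀ a : M, a < t.val v → φ.Holds A (Function.update v i a)
  | .bex i t φ, v => ∃ a : M, a < t.val v ∧ φ.Holds A (Function.update v i a)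

/-- `B` is `Σ₁` definable with the set parameter `A` and with first-order parameters from `M`,
which are the values of `v` at the variables other than `0` and `1`. -/
def SigmaOne {M : Type*} [CommSemiring M] [LinearOrder M] (A B : Set M) : Prop :=
  ∃ (φ : BddFormula) (v : ℕ → M), ∀ x : M,
    x ∈ B ↔ ∃ y : M, φ.Holds A (Function.update (Function.update v 0 x) 1 y)

/-- `B` is `Δ₁` definable with the set parameter `A`. -/
def DeltaOne {M : Type*} [CommSemiring M] [LinearOrder M] (A B : Set M) : Prop :=
  SigmaOne A B ∧ SigmaOne A Bᶜ

/-! ### Coding -/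

/-- The quadratic pairing function `⟨x, y⟩ = (x + y)² + x`. -/
def pair {M : Type*} [CommSemiring M] (x y : M) : M := (x + y) * (x + y) + x

/-- Gödel's coding of finite sets: `⟨n, ⟨a, b⟩⟩` codes the set of those `x < n` for which
`1 + (x + 1) b` divides `a`. A number that is not of this form codes the empty set. -/
def MemCode {M : Type*} [CommSemiring M] [LinearOrder M] (x c : M) : Prop :=
  ∃ n a b : M, c = pair n (pair a b) ∧ x < n ∧ (1 + (x + 1) * b) ∣ a

/-- The graph of exponentiation: `y = 2 ^ x`, as witnessed by a finite set of pairs `⟨i, 2 ^ i⟩`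
that contains with every `⟨i + 1, v⟩` also the pair justifying it. -/
def IsTwoPow {M : Type*} [CommSemiring M] [LinearOrder M] (x y : M) : Prop :=
  ∃ c : M, MemCode (pair x y) c ∧ ∀ i v : M, MemCode (pair i v) c →
    (i = 0 ∧ v = 1) ∨ ∃ j u : M, i = j + 1 ∧ v = 2 * u ∧ MemCode (pair j u) c

/-- `(M, {A}) ⊨ exp + IΣ⁰₁`: exponentiation is total, and induction holds for all sets that are
`Σ₁` in `A`. -/
structure ModelsExpISigmaOne {M : Type*} [CommSemiring M] [LinearOrder M] (A : Set M) :
    Prop where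
  exp : ∀ x : M, ∃ y : M, IsTwoPow x y
  induction : ∀ B : Set M, SigmaOne A B → 0 ∈ B → (∀ x ∈ B, x + 1 ∈ B) → ∀ x : M, x ∈ B

/-! ### Kleene's universal partial function -/

/-- One step of the evaluation of programs with oracle `B`: the value `y` of the program `c` at
the input `x` follows from the set `D` of values `⟨c', ⟨x', y'⟩⟩` (of program `c'` at `x'`).
Programs are numbers in `M`:
`⟨0, a⟩` constant function `a`; `⟨1, 0⟩` identity; `⟨1, 1⟩`, `⟨1, 2⟩` first and second component
of a pair; `⟨1, 3⟩`, `⟨1, 4⟩`, `⟨1, 5⟩` sum, product and characteristic function of `<` on pairs;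
`⟨1, 6⟩` characteristic function of the oracle; `⟨2, ⟨f, g⟩⟩` pairing of `f` and `g`;
`⟨3, ⟨f, g⟩⟩` the composition `x ↦ f (g x)`; `⟨4, f⟩` unbounded search, sending `x` to the least
`y` with `f ⟨x, y⟩ = 0`, provided `f ⟨x, z⟩` is defined for all `z < y`. -/
inductive Justified {M : Type*} [CommSemiring M] [LinearOrder M] (B D : Set M) :
    M → M → M → Prop
  | const (a x : M) : Justified B D (pair 0 a) x a
  | id (x : M) : Justified B D (pair 1 0) x x
  | left (a b : M) : Justified B D (pair 1 1) (pair a b) a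
  | right (a b : M) : Justified B D (pair 1 2) (pair a b) b
  | add (a b : M) : Justified B D (pair 1 3) (pair a b) (a + b)
  | mul (a b : M) : Justified B D (pair 1 4) (pair a b) (a * b)
  | lt_true (a b : M) : a < b → Justified B D (pair 1 5) (pair a b) 1
  | lt_false (a b : M) : ¬ a < b → Justified B D (pair 1 5) (pair a b) 0
  | oracle_true (x : M) : x ∈ B → Justified B D (pair 1 6) x 1
  | oracle_false (x : M) : x ∉ B → Justified B D (pair 1 6) x 0
  | pairing (f g x u w : M) : pair f (pair x u) ∈ D → pair g (pair x w) ∈ D →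
      Justified B D (pair 2 (pair f g)) x (pair u w)
  | comp (f g x u y : M) : pair g (pair x u) ∈ D → pair f (pair u y) ∈ D →
      Justified B D (pair 3 (pair f g)) x y
  | search (f x y : M) : pair f (pair (pair x y) 0) ∈ D →
      (∀ z : M, z < y → ∃ w : M, w ≠ 0 ∧ pair f (pair (pair x z) w) ∈ D) →
      Justified B D (pair 4 f) x y

/-- Kleene's `T`-predicate: `d` codes a computation, with oracle `B`, of the value `y` of the
program `e` at `x`, that is, a finite set of values that contains this one and each of whose
elements is justified by others. -/
def IsComputation {M : Type*} [CommSemiring M] [LinearOrder M] (B : Set M) (e x y d : M) :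
    Prop :=
  MemCode (pair e (pair x y)) d ∧
    ∀ c' x' y' : M, MemCode (pair c' (pair x' y')) d →
      Justified B {p | MemCode p d} c' x' y'

/-- `Φ_{e,s}^B(x) = y`: some computation with code below `s` gives the value `y`. -/
def PhiStage {M : Type*} [CommSemiring M] [LinearOrder M] (B : Set M) (e s x y : M) : Prop :=
  ∃ d : M, d < s ∧ IsComputation B e x y d

/-- `Φ_e^B(x) = y`. -/
def Phi {M : Type*} [CommSemiring M] [LinearOrder M] (B : Set M) (e x y : M) : Prop :=
  ∃ d : M, IsComputation B e x y d

/-- The jump `B' = {e ∈ M : Φ_e^B(e)↓}`. -/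
def jump {M : Type*} [CommSemiring M] [LinearOrder M] (B : Set M) : Set M :=
  {e | ∃ y : M, Phi B e e y}

/-- A total function `f : M → M` is computable if its graph is `Σ₁` definable without set
parameters. -/
def ComputableFun {M : Type*} [CommSemiring M] [LinearOrder M] (f : M → M) : Prop :=
  SigmaOne ∅ {p | ∃ x : M, p = pair x (f x)}

/-- Weak truth-table reducibility `A ≤_wtt B`: for some index `e` and computable `f`, the
characteristic function of `A` is `Φ_e^B`, and `Φ_{e,f(x)}^B(x)↓` for all `x`. -/
def WTTReducible {M : Type*} [CommSemiring M] [LinearOrder M] (A B : Set M) : Prop :=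
  ∃ (e : M) (f : M → M), ComputableFun f ∧
    (∀ x : M, (x ∈ A → Phi B e x 1) ∧ (x ∉ A → Phi B e x 0)) ∧
    ∀ x : M, ∃ y : M, PhiStage B e (f x) x y

/-! ### Binary strings, trees and paths -/

/-- `p` is a power of two: every divisor of `p` other than `1` is even. -/
def IsPowerOfTwo {M : Type*} [CommSemiring M] (p : M) : Prop :=
  p ≠ 0 ∧ ∀ q : M, q ∣ p → q ≠ 1 → 2 ∣ q

/-- Binary strings are coded by the numbers `≥ 1`, a string being read in base two after
prepending the digit `1`. The string `τ` is an initial segment of `σ` if `τ` arises from `σ` by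
deleting some number of final digits, that is, if `τ = ⌊σ / p⌋` for a power of two `p`. -/
def IsInitialSegment {M : Type*} [CommSemiring M] [LinearOrder M] (τ σ : M) : Prop :=
  1 ≤ τ ∧ ∃ p : M, IsPowerOfTwo p ∧ τ * p ≤ σ ∧ σ < (τ + 1) * p

/-- A binary tree: a set of binary strings that is closed under initial segments. -/
def IsBinaryTree {M : Type*} [CommSemiring M] [LinearOrder M] (T : Set M) : Prop :=
  (∀ σ ∈ T, 1 ≤ σ) ∧ ∀ σ ∈ T, ∀ τ : M, IsInitialSegment τ σ → τ ∈ T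

/-- A path: a binary tree that is totally ordered by end-extension. -/
def IsPath {M : Type*} [CommSemiring M] [LinearOrder M] (P : Set M) : Prop :=
  IsBinaryTree P ∧ ∀ σ ∈ P, ∀ τ ∈ P, IsInitialSegment σ τ ∨ IsInitialSegment τ σ

/-- Infinite means unbounded in `M`. -/
def IsInfinite {M : Type*} [LinearOrder M] (B : Set M) : Prop :=
  ¬ ∃ b : M, ∀ a ∈ B, a < b

end RevRec

namespace RevRec

set_option linter.unusedSectionVars false

universe u

/-! ### Arithmetic in models of `P⁻` -/

section Arithmetic

variable {M : Type*} [CommSemiring M] [LinearOrder M] [PMinus M]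

/-! The proof is Jockusch–Soare forcing with subtrees, arranged so that induction is needed only for
sets that are `Σ₁` in `T`. Programs `i` are decided in increasing order. Given the set `c` of
earlier programs that were made to halt, consider the strings of `T` on which no earlier program
outside `c` halts. If those among them on which `i` does not halt either are bounded, then `i` has
to halt along the path; otherwise one passes to the subtree where it does not halt. The first
alternative, `Forced`, is `Σ₁` in `T`, uniformly in `c` and `i`, because a bound can be checked on
an interval `[b, 2b)`: every string `≥ b` has an initial segment there (`exists_isInitialSegment`).

`exists_correct` codes any finite stretch of these decisions, by bounded `Σ₁` comprehension
(`exists_code`). `Correct.exists_avoids` shows by `Π₁` induction that the remaining subtree is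
always unbounded. The path is read off from the decisions: `σ` belongs to it iff the program `escape
σ`, which halts exactly when `σ` is missing from the oracle, is not forced to halt. Comparison with
long strings of the remaining subtrees shows that this is an infinite path in `T`
(`exists_mem_forcedPath`) whose jump is exactly the set of forced programs (`jump_forcedPath`).

It remains to reduce the decisions to `T'` (`wttReducible_forcedSet`). Each instance of `Forced` is
one query to `T'`, and a code `c` is correct iff it agrees with `T'` at the queries built from `c`
itself; so `x` is decided by searching the codes below a computable bound. A computable bound on the
stage, and not only on the queries, is obtained by running the same program on all finite oracles of
the relevant size and taking a common bound for their computations. -/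

theorem lt_succ_iff {a b : M} : a < b + 1 ↔ a ≤ b := by
  constructor
  · intro h
    by_contra hn
    push Not at hn
    obtain ⟨z, rfl⟩ := exists_add_of_le hn.le
    have hz : 0 < z := by
      rcases (zero_le : 0 ≤ z).eq_or_lt with h0 | h0
      · subst h0; simp at hn
      · exact h0
    have := PMinus.one_le_of_pos z hz
    grind
  · intro h
    have : (0 : M) < 1 := zero_lt_one
    grind

theorem succ_le_iff {a b : M} : a + 1 ≤ b ↔ a < b := by
  rw [← not_lt, lt_succ_iff, not_le]

theorem lt_succ_self (a : M) : a < a + 1 := lt_succ_iff.2 le_rfl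

theorem eq_zero_or_succ (a : M) : a = 0 ∨ ∃ b, a = b + 1 := by
  rcases (zero_le : 0 ≤ a).eq_or_lt with h | h
  · exact Or.inl h.symm
  · obtain ⟨b, hb⟩ := exists_add_of_le (PMinus.one_le_of_pos a h)
    exact Or.inr ⟨b, by rw [hb, add_comm]⟩

theorem lt_succ_cases {a b : M} (h : a < b + 1) : a < b ∨ a = b :=
  (lt_succ_iff.1 h).lt_or_eq

theorem pos_of_ne_zero' {a : M} (h : a ≠ 0) : 0 < a := lt_of_le_of_ne zero_le h.symm

theorem le_mul_self' (a : M) : a ≤ a * a := by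
  rcases eq_zero_or_succ a with rfl | ⟨b, rfl⟩
  · simp
  · exact le_mul_of_one_le_right zero_le (le_add_of_nonneg_left zero_le)

theorem le_mul_of_pos {a b : M} (h : 0 < b) : a ≤ a * b :=
  le_mul_of_one_le_right zero_le (PMinus.one_le_of_pos b h)

theorem add_le_pair (x y : M) : x + y ≤ pair x y :=
  (le_mul_self' _).trans (le_add_of_nonneg_right zero_le)

theorem left_le_pair (x y : M) : x ≤ pair x y :=
  (le_add_of_nonneg_right zero_le).trans (add_le_pair x y)

theorem right_le_pair (x y : M) : y ≤ pair x y :=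
  (le_add_of_nonneg_left zero_le).trans (add_le_pair x y)

theorem pair_le_pair {x y x' y' : M} (hx : x ≤ x') (hy : y ≤ y') : pair x y ≤ pair x' y' := by
  unfold pair
  have h : x + y ≤ x' + y' := add_le_add hx hy
  exact add_le_add (mul_le_mul' h h) hx

theorem pair_lt_pair_right {x y y' : M} (hy : y < y') : pair x y < pair x y' := by
  unfold pair
  have h : x + y < x + y' := by grind
  have h0 : (0 : M) ≤ x + y := zero_le
  have := mul_self_lt_mul_self h0 h
  grind

theorem pair_inj {x y x' y' : M} (h : pair x y = pair x' y') : x = x' ∧ y = y' := by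
  have key : ∀ {a b c d : M}, pair a b = pair c d → ¬ a + b < c + d := by
    intro a b c d h hlt
    have h1 := mul_le_mul' (succ_le_iff.2 hlt) (succ_le_iff.2 hlt)
    unfold pair at h
    have h2 : (0 : M) ≤ c := zero_le
    have h3 : (0 : M) ≤ b := zero_le
    have h4 : (0 : M) ≤ a := zero_le
    have h5 : (0 : M) < 1 := zero_lt_one
    have h6 : (c + d) * (c + d) ≤ (a + b) * (a + b) + a := by grind
    have h7 := h1.trans h6
    have h8 : (a + b + 1) * (a + b + 1) = (a + b) * (a + b) + (a + b + (a + b) + 1) := by ring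
    rw [h8] at h7
    have h9 := le_of_add_le_add_left h7
    grind
  have hs : x + y = x' + y' :=
    le_antisymm (not_lt.1 (key h.symm)) (not_lt.1 (key h))
  unfold pair at h
  rw [hs] at h
  have hx := add_left_cancel h
  subst hx
  exact ⟨rfl, add_left_cancel hs⟩

@[simp] theorem pair_eq_pair {x y x' y' : M} : pair x y = pair x' y' ↔ x = x' ∧ y = y' :=
  ⟨pair_inj, fun h => by rw [h.1, h.2]⟩

/-! ### Divisibility without subtraction and the moduli of Gödel's coding. -/

theorem dvd_of_dvd_add {m u v : M} (h : m ∣ u + v) (hu : m ∣ u) : m ∣ v := by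
  obtain ⟨s, rfl⟩ := hu
  obtain ⟨t, ht⟩ := h
  rcases (zero_le : 0 ≤ m).eq_or_lt with h0 | h0
  · subst h0
    simp at ht
    simp [ht]
  · have hst : s ≤ t := by
      refine le_of_mul_le_mul_left ?_ h0
      rw [← ht]
      exact le_add_of_nonneg_right zero_le
    obtain ⟨r, rfl⟩ := exists_add_of_le hst
    refine ⟨r, ?_⟩
    rw [mul_add] at ht
    exact add_left_cancel ht

/-- The modulus attached to `x` in Gödel's coding of finite sets. -/
abbrev modulus (b x : M) : M := 1 + (x + 1) * b

/-- The factor `b` cancels since it is invertible modulo `1 + (x + 1) b`: its product with `x + 1`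
is `-1`. -/
theorem dvd_of_modulus_dvd_mul {a b r x : M} (h : modulus b x ∣ a * (r * b)) :
    modulus b x ∣ a * r := by
  have h1 : modulus b x ∣ a * r * ((x + 1) * b) + a * r := by
    refine ⟨a * r, ?_⟩
    ring
  refine dvd_of_dvd_add h1 ?_
  obtain ⟨s, hs⟩ := h
  exact ⟨s * (x + 1), by rw [← mul_assoc (modulus b x), ← hs]; ring⟩

/-- This replaces coprimality of the moduli. Two of them differ by `r * b` with `0 < r ≤ n`, so `r ∣
b`; modulo the first, both `b` and its divisor `r` can be cancelled. -/
theorem modulus_dvd_of_dvd_mul {n a b x k : M} (hb : ∀ i < n, i + 1 ∣ b) (hx : x < n) (hk : k < n)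
    (hxk : x ≠ k) (h : modulus b x ∣ a * modulus b k) : modulus b x ∣ a := by
  have main : ∀ r : M, r ∣ b → modulus b x ∣ a * (r * b) → modulus b x ∣ a := by
    intro r ⟨s, hs⟩ h
    have h1 := dvd_of_modulus_dvd_mul h
    have h2 : modulus b x ∣ a * (1 * b) := by
      rw [one_mul]
      nth_rewrite 2 [hs]
      rw [← mul_assoc]
      exact h1.mul_right s
    simpa using dvd_of_modulus_dvd_mul h2
  have hdvd : ∀ r : M, r ≠ 0 → r ≤ n → r ∣ b := by
    intro r hr hrn
    obtain ⟨j, rfl⟩ := (eq_zero_or_succ r).resolve_left hr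
    exact hb j (succ_le_iff.1 hrn)
  rcases lt_or_gt_of_ne hxk with hlt | hlt
  · obtain ⟨r, rfl⟩ := exists_add_of_le hlt.le
    have hr : r ≠ 0 := by rintro rfl; simp at hlt
    refine main r (hdvd r hr ((le_add_of_nonneg_left zero_le).trans hk.le)) ?_
    have e : a * modulus b (x + r) = a * modulus b x + a * (r * b) := by
      unfold modulus; ring
    rw [e] at h
    exact dvd_of_dvd_add h (dvd_mul_left _ _)
  · obtain ⟨r, rfl⟩ := exists_add_of_le hlt.le
    have hr : r ≠ 0 := by rintro rfl; simp at hlt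
    refine main r (hdvd r hr ((le_add_of_nonneg_left zero_le).trans hx.le)) ?_
    have e : a * modulus b (k + r) = a * (r * b) + a * modulus b k := by
      unfold modulus; ring
    have h2 : modulus b (k + r) ∣ a * modulus b k + a * (r * b) := by
      rw [add_comm (a * modulus b k), ← e]; exact dvd_mul_left _ _
    exact dvd_of_dvd_add h2 h

theorem MemCode.lt {x c : M} (h : MemCode x c) : x < c := by
  obtain ⟨n, a, b, rfl, hx, -⟩ := h
  exact hx.trans_le (left_le_pair _ _)

theorem not_modulus_dvd_one {b x : M} (hb : 0 < b) : ¬ modulus b x ∣ 1 := by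
  rintro ⟨s, hs⟩
  have h1 : 0 < (x + 1) * b :=
    mul_pos (lt_of_le_of_lt (zero_le : 0 ≤ x) (lt_succ_self x)) hb
  have hs0 : 0 < s := by
    apply pos_of_ne_zero'
    rintro rfl
    simp at hs
  have h2 := PMinus.one_le_of_pos s hs0
  have h3 := le_mul_of_pos (a := modulus b x) hs0
  rw [← hs] at h3
  unfold modulus at h3
  grind

end Arithmetic

/-! ### Renaming of variables -/

section Renaming

/-- Renaming of the variables of a term. -/
def ArithTerm.rename (f : ℕ → ℕ) : ArithTerm → ArithTerm
  | .var i => .var (f i)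
  | .zero => .zero
  | .one => .one
  | .add s t => .add (s.rename f) (t.rename f)
  | .mul s t => .mul (s.rename f) (t.rename f)

/-- Renaming of the free and bound variables of a bounded formula. -/
def BddFormula.rename (f : ℕ → ℕ) : BddFormula → BddFormula
  | .eq s t => .eq (s.rename f) (t.rename f)
  | .lt s t => .lt (s.rename f) (t.rename f)
  | .mem t => .mem (t.rename f)
  | .not φ => .not (φ.rename f)
  | .and φ ψ => .and (φ.rename f) (ψ.rename f)
  | .or φ ψ => .or (φ.rename f) (ψ.rename f)
  | .ball i t φ => .ball (f i) (t.rename f) (φ.rename f)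
  | .bex i t φ => .bex (f i) (t.rename f) (φ.rename f)

variable {M : Type*} [CommSemiring M] [LinearOrder M]

theorem ArithTerm.val_rename (f : ℕ → ℕ) (v : ℕ → M) (t : ArithTerm) :
    (t.rename f).val v = t.val (v ∘ f) := by
  induction t <;> simp_all [ArithTerm.rename, ArithTerm.val]

theorem BddFormula.holds_rename {f : ℕ → ℕ} (hf : Function.Injective f) (B : Set M)
    (φ : BddFormula) (v : ℕ → M) : (φ.rename f).Holds B v ↔ φ.Holds B (v ∘ f) := by
  induction φ generalizing v <;>
    simp_all [BddFormula.rename, BddFormula.Holds, ArithTerm.val_rename,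
      Function.update_comp_eq_of_injective _ hf]

/-- The assignment with the values of `v` at the even and those of `p` at the odd variables. -/
def mix (v p : ℕ → M) (k : ℕ) : M := if k % 2 = 0 then v (k / 2) else p (k / 2)

@[simp] theorem mix_even (v p : ℕ → M) (i : ℕ) : mix v p (2 * i) = v i := by simp [mix]

@[simp] theorem mix_odd (v p : ℕ → M) (i : ℕ) : mix v p (2 * i + 1) = p i := by
  have h : (2 * i + 1) / 2 = i := by omega
  simp [mix, h]

theorem update_mix (v p : ℕ → M) (i : ℕ) (a : M) :
    Function.update (mix v p) (2 * i) a = mix (Function.update v i a) p := by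
  ext k
  rcases Nat.even_or_odd' k with ⟨j, rfl | rfl⟩
  · by_cases h : j = i
    · subst h; simp
    · rw [Function.update_of_ne (by omega), mix_even, mix_even, Function.update_of_ne h]
  · rw [Function.update_of_ne (by omega), mix_odd, mix_odd]

/-- Renaming that moves the parameters to the even parameter slots. -/
def mergeLeft (k : ℕ) : ℕ := if k % 2 = 0 then k else 2 * k - 1

/-- Renaming that moves the parameters to the odd parameter slots. -/
def mergeRight (k : ℕ) : ℕ := if k % 2 = 0 then k else 2 * k + 1

theorem mergeLeft_injective : Function.Injective mergeLeft := by
  intro a b h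
  unfold mergeLeft at h
  split_ifs at h <;> omega

theorem mergeRight_injective : Function.Injective mergeRight := by
  intro a b h
  unfold mergeRight at h
  split_ifs at h <;> omega

theorem mix_mergeLeft (v p q : ℕ → M) : mix v (mix p q) ∘ mergeLeft = mix v p := by
  ext k
  rcases Nat.even_or_odd' k with ⟨j, rfl | rfl⟩
  · simp [mergeLeft]
  · have h : mergeLeft (2 * j + 1) = 2 * (2 * j) + 1 := by
      unfold mergeLeft; rw [if_neg (by omega)]; omega
    rw [Function.comp_apply, h, mix_odd, mix_odd, mix_even]

theorem mix_mergeRight (v p q : ℕ → M) : mix v (mix p q) ∘ mergeRight = mix v q := by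
  ext k
  rcases Nat.even_or_odd' k with ⟨j, rfl | rfl⟩
  · simp [mergeRight]
  · have h : mergeRight (2 * j + 1) = 2 * (2 * j + 1) + 1 := by
      unfold mergeRight; rw [if_neg (by omega)]
    rw [Function.comp_apply, h, mix_odd, mix_odd, mix_odd]

end Renaming

/-! ### Definable relations -/

section Definability

/-- A context: the elements of `X` are finite tuples of elements of `M`. -/
class Ctx (M : Type u) [Zero M] (X : Type u) where
  /-- the length of the tuples -/
  size : ℕ
  /-- the components of a tuple, followed by zeros -/
  env : X → ℕ → M
  env_of_size_le : ∀ x i, size ≤ i → env x i = 0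

instance (M : Type u) [Zero M] : Ctx M PUnit.{u + 1} where
  size := 0
  env _ _ := 0
  env_of_size_le _ _ _ := rfl

instance (M : Type u) [Zero M] (X : Type u) [Ctx M X] : Ctx M (X × M) where
  size := Ctx.size M X + 1
  env x := Function.update (Ctx.env x.1) (Ctx.size M X) x.2
  env_of_size_le x i h := by
    rw [Function.update_of_ne (by omega), Ctx.env_of_size_le _ _ (by omega)]

variable {M : Type u} [CommSemiring M] [LinearOrder M] {X : Type u} [Ctx M X]
  {Y : Type u} [Ctx M Y]

theorem env_prod (x : X) (a : M) :
    (Ctx.env (x, a) : ℕ → M) = Function.update (Ctx.env x) (Ctx.size M X) a := rfl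

/-- `f` is given by a term with parameters. -/
class Tm (f : X → M) : Prop where
  out : ∃ (t : ArithTerm) (p : ℕ → M), ∀ x, f x = t.val (mix (Ctx.env x) p)

/-- `R` is defined by a bounded formula with parameters and with the set parameter `B`. -/
class Bdd (B : Set M) (R : X → Prop) : Prop where
  out : ∃ (φ : BddFormula) (p : ℕ → M), ∀ x, R x ↔ φ.Holds B (mix (Ctx.env x) p)

/-- The components of `k` are given by terms. -/
class TmMap (M : Type u) [CommSemiring M] [LinearOrder M] {X Y : Type u} [Ctx M X] [Ctx M Y]
    (k : X → Y) : Prop where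
  out : ∀ i, Tm (fun x => (Ctx.env (k x) i : M))

instance Tm.const (c : M) : Tm (fun _ : X => c) :=
  ⟨.var 1, fun _ => c, fun x => by simpa [ArithTerm.val] using (mix_odd (Ctx.env x) (fun _ => c) 0).symm⟩

instance Tm.snd : Tm (fun p : X × M => p.2) :=
  ⟨.var (2 * Ctx.size M X), fun _ => 0, fun ⟨x, a⟩ => by simp [ArithTerm.val, env_prod]⟩

theorem Tm.env (i : ℕ) : Tm (fun x : X => (Ctx.env x i : M)) :=
  ⟨.var (2 * i), fun _ => 0, fun x => by simp [ArithTerm.val]⟩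

theorem Tm.lift {f : X → M} (hf : Tm f) : Tm (fun p : X × M => f p.1) := by
  obtain ⟨t, p, h⟩ := hf.out
  -- In the longer tuple the variable `Ctx.size M X` carries the new component, whereas `t` expects
  -- `0` there. It is redirected to a new parameter with value `0`, and the old parameters move up
  -- by one place.
  let ρ : ℕ → ℕ := fun k => if k % 2 = 0 then (if k = 2 * Ctx.size M X then 1 else k) else k + 2
  refine ⟨t.rename ρ, fun i => if i = 0 then 0 else p (i - 1), fun x => ?_⟩
  rw [h, ArithTerm.val_rename]
  congr 1
  ext k
  rcases Nat.even_or_odd' k with ⟨j, rfl | rfl⟩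
  · by_cases hj : j = Ctx.size M X
    · have e : ρ (2 * j) = 2 * 0 + 1 := by simp [ρ, hj]
      rw [Function.comp_apply, e, mix_even, mix_odd, if_pos rfl, hj]
      exact Ctx.env_of_size_le _ _ le_rfl
    · have e : ρ (2 * j) = 2 * j := by simp [ρ, hj]
      rw [Function.comp_apply, e, mix_even, mix_even]
      exact (Function.update_of_ne hj _ _).symm
  · have e : ρ (2 * j + 1) = 2 * (j + 1) + 1 := by
      simp only [ρ]; rw [if_neg (by omega)]; ring
    rw [Function.comp_apply, e, mix_odd, mix_odd]
    simp

/-- Two parameter sequences are interleaved into one, while the even slots, which hold the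
variables, stay fixed. -/
theorem Tm.merge {f g : X → M} (hf : Tm f) (hg : Tm g) : ∃ (s t : ArithTerm) (p : ℕ → M),
    (∀ x, f x = s.val (mix (Ctx.env x) p)) ∧ ∀ x, g x = t.val (mix (Ctx.env x) p) := by
  obtain ⟨s, p, hs⟩ := hf.out
  obtain ⟨t, q, ht⟩ := hg.out
  refine ⟨s.rename mergeLeft, t.rename mergeRight, mix p q, fun x => ?_, fun x => ?_⟩
  · rw [ArithTerm.val_rename, mix_mergeLeft, hs]
  · rw [ArithTerm.val_rename, mix_mergeRight, ht]

instance Tm.add (f g : X → M) [hf : Tm f] [hg : Tm g] : Tm (fun x => f x + g x) := by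
  obtain ⟨s, t, p, hs, ht⟩ := hf.merge hg
  exact ⟨.add s t, p, fun x => by simp [ArithTerm.val, hs, ht]⟩

instance Tm.mul (f g : X → M) [hf : Tm f] [hg : Tm g] : Tm (fun x => f x * g x) := by
  obtain ⟨s, t, p, hs, ht⟩ := hf.merge hg
  exact ⟨.mul s t, p, fun x => by simp [ArithTerm.val, hs, ht]⟩

instance Tm.pair (f g : X → M) [hf : Tm f] [hg : Tm g] : Tm (fun x => pair (f x) (g x)) := by
  unfold RevRec.pair
  infer_instance

/-! Variables. -/

instance : Tm (fun p : (X × M) × M => p.1.2) := Tm.snd.lift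
instance : Tm (fun p : ((X × M) × M) × M => p.1.1.2) := Tm.snd.lift.lift
instance : Tm (fun p : (((X × M) × M) × M) × M => p.1.1.1.2) := Tm.snd.lift.lift.lift
instance : Tm (fun p : ((((X × M) × M) × M) × M) × M => p.1.1.1.1.2) :=
  Tm.snd.lift.lift.lift.lift
instance : Tm (fun p : (((((X × M) × M) × M) × M) × M) × M => p.1.1.1.1.1.2) :=
  Tm.snd.lift.lift.lift.lift.lift
instance : Tm (fun p : ((((((X × M) × M) × M) × M) × M) × M) × M => p.1.1.1.1.1.1.2) :=
  Tm.snd.lift.lift.lift.lift.lift.lift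
instance : Tm (fun p : (((((((X × M) × M) × M) × M) × M) × M) × M) × M => p.1.1.1.1.1.1.1.2) :=
  Tm.snd.lift.lift.lift.lift.lift.lift.lift
theorem TmMap.lift {k : X → Y} (h : TmMap M k) : TmMap M (fun p : X × M => k p.1) :=
  ⟨fun i => (h.out i).lift⟩

instance TmMap.id : TmMap M (fun x : X => x) := ⟨fun i => Tm.env i⟩
instance TmMap.const (y : Y) : TmMap M (fun _ : X => y) := ⟨fun _ => inferInstance⟩
instance TmMap.prod (k : X → Y) (f : X → M) [hk : TmMap M k] [hf : Tm f] :
    TmMap M (fun x => (k x, f x)) := by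
  refine ⟨fun i => ?_⟩
  by_cases h : i = Ctx.size M Y
  · subst h
    simpa [env_prod] using hf
  · simpa [env_prod, Function.update_of_ne h] using hk.out i

instance TmMap.fst : TmMap M (fun p : X × M => p.1) := (TmMap.id (M := M)).lift
instance : TmMap M (fun p : (X × M) × M => p.1.1) := TmMap.fst.lift
instance : TmMap M (fun p : ((X × M) × M) × M => p.1.1.1) := TmMap.fst.lift.lift
instance : TmMap M (fun p : (((X × M) × M) × M) × M => p.1.1.1.1) := TmMap.fst.lift.lift.lift
instance : TmMap M (fun p : ((((X × M) × M) × M) × M) × M => p.1.1.1.1.1) :=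
  TmMap.fst.lift.lift.lift.lift
instance : TmMap M (fun p : (((((X × M) × M) × M) × M) × M) × M => p.1.1.1.1.1.1) :=
  TmMap.fst.lift.lift.lift.lift.lift
variable (B : Set M)

theorem Bdd.congr {B : Set M} {R S : X → Prop} (hR : Bdd B R) (h : ∀ x, S x ↔ R x) : Bdd B S := by
  rwa [show S = R from funext fun x => propext (h x)]

theorem Bdd.merge {B : Set M} {R S : X → Prop} (hR : Bdd B R) (hS : Bdd B S) :
    ∃ (φ ψ : BddFormula) (p : ℕ → M), (∀ x, R x ↔ φ.Holds B (mix (Ctx.env x) p)) ∧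
      ∀ x, S x ↔ ψ.Holds B (mix (Ctx.env x) p) := by
  obtain ⟨φ, p, hφ⟩ := hR.out
  obtain ⟨ψ, q, hψ⟩ := hS.out
  refine ⟨φ.rename mergeLeft, ψ.rename mergeRight, mix p q, fun x => ?_, fun x => ?_⟩
  · rw [BddFormula.holds_rename mergeLeft_injective, mix_mergeLeft, hφ]
  · rw [BddFormula.holds_rename mergeRight_injective, mix_mergeRight, hψ]

instance Bdd.eq (f g : X → M) [hf : Tm f] [hg : Tm g] : Bdd B (fun x => f x = g x) := by
  obtain ⟨s, t, p, hs, ht⟩ := hf.merge hg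
  exact ⟨.eq s t, p, fun x => by simp [BddFormula.Holds, hs, ht]⟩

instance Bdd.lt (f g : X → M) [hf : Tm f] [hg : Tm g] : Bdd B (fun x => f x < g x) := by
  obtain ⟨s, t, p, hs, ht⟩ := hf.merge hg
  exact ⟨.lt s t, p, fun x => by simp [BddFormula.Holds, hs, ht]⟩

instance Bdd.mem (f : X → M) [hf : Tm f] : Bdd B (fun x => f x ∈ B) := by
  obtain ⟨s, p, hs⟩ := hf.out
  exact ⟨.mem s, p, fun x => by simp [BddFormula.Holds, hs]⟩

instance Bdd.not (R : X → Prop) [hR : Bdd B R] : Bdd B (fun x => ¬ R x) := by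
  obtain ⟨φ, p, h⟩ := hR.out
  exact ⟨.not φ, p, fun x => by simp [BddFormula.Holds, h]⟩

instance Bdd.and (R S : X → Prop) [hR : Bdd B R] [hS : Bdd B S] :
    Bdd B (fun x => R x ∧ S x) := by
  obtain ⟨φ, ψ, p, h, h'⟩ := hR.merge hS
  exact ⟨.and φ ψ, p, fun x => by simp [BddFormula.Holds, h, h']⟩

instance Bdd.or (R S : X → Prop) [hR : Bdd B R] [hS : Bdd B S] :
    Bdd B (fun x => R x ∨ S x) := by
  obtain ⟨φ, ψ, p, h, h'⟩ := hR.merge hS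
  exact ⟨.or φ ψ, p, fun x => by simp [BddFormula.Holds, h, h']⟩

instance Bdd.imp (R S : X → Prop) [hR : Bdd B R] [hS : Bdd B S] :
    Bdd B (fun x => R x → S x) :=
  (Bdd.or B (fun x => ¬ R x) S).congr fun _ => imp_iff_not_or

instance Bdd.iff (R S : X → Prop) [hR : Bdd B R] [hS : Bdd B S] :
    Bdd B (fun x => R x ↔ S x) :=
  (Bdd.and B (fun x => R x → S x) (fun x => S x → R x)).congr fun _ => iff_iff_implies_and_implies

instance Bdd.le (f g : X → M) [hf : Tm f] [hg : Tm g] : Bdd B (fun x => f x ≤ g x) :=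
  (Bdd.not B (fun x => g x < f x)).congr fun _ => not_lt.symm

instance Bdd.prop (q : Prop) : Bdd B (fun _ : X => q) := by
  by_cases h : q
  · exact (Bdd.eq B (fun _ : X => (0 : M)) (fun _ => 0)).congr fun _ => by simp [h]
  · exact (Bdd.not B (fun _ : X => (0 : M) = 0)).congr fun _ => by simp [h]

instance Bdd.ball (t : X → M) (R : X → M → Prop) [ht : Tm t]
    [hR : Bdd B (fun p : X × M => R p.1 p.2)] : Bdd B (fun x => ∀ a, a < t x → R x a) := by
  obtain ⟨φ, p, h⟩ := hR.out
  obtain ⟨s, q, hs⟩ := ht.out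
  refine ⟨.ball (2 * Ctx.size M X) (s.rename mergeRight) (φ.rename mergeLeft), mix p q,
    fun x => ?_⟩
  refine forall_congr' fun a => ?_
  rw [ArithTerm.val_rename, mix_mergeRight, ← hs, update_mix,
    BddFormula.holds_rename mergeLeft_injective, mix_mergeLeft]
  exact imp_congr_right fun _ => h (x, a)

instance Bdd.bex (t : X → M) (R : X → M → Prop) [ht : Tm t]
    [hR : Bdd B (fun p : X × M => R p.1 p.2)] : Bdd B (fun x => ∃ a, a < t x ∧ R x a) :=
  (Bdd.not B (fun x => ∀ a, a < t x → ¬ R x a)).congr fun x => by simp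

instance Bdd.ball_le [PMinus M] (t : X → M) (R : X → M → Prop) [ht : Tm t]
    [hR : Bdd B (fun p : X × M => R p.1 p.2)] : Bdd B (fun x => ∀ a, a ≤ t x → R x a) :=
  (inferInstance : Bdd B (fun x => ∀ a, a < t x + 1 → R x a)).congr fun x => by
    simp [lt_succ_iff]

instance Bdd.bex_le [PMinus M] (t : X → M) (R : X → M → Prop) [ht : Tm t]
    [hR : Bdd B (fun p : X × M => R p.1 p.2)] : Bdd B (fun x => ∃ a, a ≤ t x ∧ R x a) :=
  (inferInstance : Bdd B (fun x => ∃ a, a < t x + 1 ∧ R x a)).congr fun x => by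
    simp [lt_succ_iff]

theorem ArithTerm.tm_val {k : X → ℕ → M} (hk : ∀ i, Tm (fun x => k x i)) (t : ArithTerm) :
    Tm (fun x => t.val (k x)) := by
  induction t with
  | var i => exact hk i
  | zero => exact Tm.const 0
  | one => exact Tm.const 1
  | add s t hs ht => exact Tm.add _ _
  | mul s t hs ht => exact Tm.mul _ _

theorem tm_update {k : X → ℕ → M} (hk : ∀ i, Tm (fun x => k x i)) (i j : ℕ) :
    Tm (fun p : X × M => Function.update (k p.1) i p.2 j) := by
  by_cases h : j = i
  · subst h; simpa using Tm.snd
  · simpa [Function.update_of_ne h] using (hk j).lift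

/-- Substitution of terms, done semantically: a quantifier extends the tuple by a fresh component,
so no capture of variables can occur. -/
theorem BddFormula.bdd_holds (φ : BddFormula) {X : Type u} [Ctx M X] {k : X → ℕ → M}
    (hk : ∀ i, Tm (fun x => k x i)) : Bdd B (fun x => φ.Holds B (k x)) := by
  induction φ generalizing X with
  | eq s t => have := s.tm_val hk; have := t.tm_val hk; exact Bdd.eq B _ _
  | lt s t => have := s.tm_val hk; have := t.tm_val hk; exact Bdd.lt B _ _
  | mem t => have := t.tm_val hk; exact Bdd.mem B _
  | not φ h => have := h hk; exact Bdd.not B _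
  | and φ ψ h h' => have := h hk; have := h' hk; exact Bdd.and B _ _
  | or φ ψ h h' => have := h hk; have := h' hk; exact Bdd.or B _ _
  | ball i t φ h =>
    have := t.tm_val hk
    have := h (tm_update hk i)
    exact Bdd.ball B _ (fun x a => φ.Holds B (Function.update (k x) i a))
  | bex i t φ h =>
    have := t.tm_val hk
    have := h (tm_update hk i)
    exact Bdd.bex B _ (fun x a => φ.Holds B (Function.update (k x) i a))

theorem TmMap.mix {k : X → Y} (hk : TmMap M k) (p : ℕ → M) (i : ℕ) :
    Tm (fun x => RevRec.mix (Ctx.env (k x)) p i) := by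
  rcases Nat.even_or_odd' i with ⟨j, rfl | rfl⟩
  · simpa using hk.out j
  · simpa using Tm.const (p j)

theorem Bdd.comp {B : Set M} {R : Y → Prop} (hR : Bdd B R) (k : X → Y) [hk : TmMap M k] :
    Bdd B (fun x => R (k x)) := by
  obtain ⟨φ, p, h⟩ := hR.out
  exact (φ.bdd_holds B (hk.mix p)).congr fun x => h (k x)

end Definability

/-! ### `Σ₁` relations and induction -/

section SigmaOneRelations

variable {M : Type u} [CommSemiring M] [LinearOrder M] [PMinus M] {X : Type u} [Ctx M X]
  {Y : Type u} [Ctx M Y] (B : Set M)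

/-- `R` is defined by a `Σ₁` formula with parameters and with the set parameter `B`. -/
class Sg (B : Set M) (R : X → Prop) : Prop where
  out : ∃ S : X × M → Prop, Bdd B S ∧ ∀ x, R x ↔ ∃ y, S (x, y)

/-- Induction for the sets that are `Σ₁` in `B`. -/
class ISig (B : Set M) : Prop where
  induction : ∀ S : Set M, SigmaOne B S → 0 ∈ S → (∀ x ∈ S, x + 1 ∈ S) → ∀ x : M, x ∈ S

theorem Sg.congr {B : Set M} {R S : X → Prop} (hR : Sg B R) (h : ∀ x, S x ↔ R x) : Sg B S := by
  rwa [show S = R from funext fun x => propext (h x)]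

theorem Sg.comp {B : Set M} {R : Y → Prop} (hR : Sg B R) (k : X → Y) [hk : TmMap M k] :
    Sg B (fun x => R (k x)) := by
  obtain ⟨S, hS, h⟩ := hR.out
  have : TmMap M (fun p : X × M => k p.1) := hk.lift
  exact ⟨fun p => S (k p.1, p.2), hS.comp (fun p : X × M => (k p.1, p.2)), fun x => h (k x)⟩

instance (priority := low) Sg.of_bdd (R : X → Prop) [hR : Bdd B R] : Sg B R :=
  ⟨fun p => R p.1, hR.comp (fun p : X × M => p.1), fun x => by simp⟩

/-- Two unbounded quantifiers are contracted to one that bounds both witnesses; no decoding of pairs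
is needed. -/
instance Sg.ex (R : X → M → Prop) [hR : Sg B (fun p : X × M => R p.1 p.2)] :
    Sg B (fun x => ∃ a, R x a) := by
  obtain ⟨S, hS, h⟩ := hR.out
  refine ⟨fun p => ∃ a, a ≤ p.2 ∧ ∃ y, y ≤ p.2 ∧ S ((p.1, a), y), ?_, fun x => ?_⟩
  · have := hS.comp (fun p : ((X × M) × M) × M => ((p.1.1.1, p.1.2), p.2))
    infer_instance
  · constructor
    · rintro ⟨a, ha⟩
      obtain ⟨y, hy⟩ := (h (x, a)).1 ha
      exact ⟨max a y, a, le_max_left _ _, y, le_max_right _ _, hy⟩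
    · rintro ⟨s, a, -, y, -, hy⟩
      exact ⟨a, (h (x, a)).2 ⟨y, hy⟩⟩

instance Sg.and (R S : X → Prop) [hR : Sg B R] [hS : Sg B S] : Sg B (fun x => R x ∧ S x) := by
  obtain ⟨R', hR', h⟩ := hR.out
  obtain ⟨S', hS', h'⟩ := hS.out
  have := hR'.comp (fun p : (X × M) × M => (p.1.1, p.1.2))
  have := hS'.comp (fun p : (X × M) × M => (p.1.1, p.2))
  refine (inferInstance : Sg B (fun x => ∃ a b, R' (x, a) ∧ S' (x, b))).congr fun x => ?_
  simp [h, h']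

instance Sg.or (R S : X → Prop) [hR : Sg B R] [hS : Sg B S] : Sg B (fun x => R x ∨ S x) := by
  obtain ⟨R', hR', h⟩ := hR.out
  obtain ⟨S', hS', h'⟩ := hS.out
  have := hR'.comp (fun p : X × M => (p.1, p.2))
  have := hS'.comp (fun p : X × M => (p.1, p.2))
  refine (inferInstance : Sg B (fun x => ∃ a, R' (x, a) ∨ S' (x, a))).congr fun x => ?_
  simp [h, h', exists_or]

instance Sg.imp (R S : X → Prop) [hR : Bdd B R] [hS : Sg B S] : Sg B (fun x => R x → S x) :=
  (Sg.or B (fun x => ¬ R x) S).congr fun _ => imp_iff_not_or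

theorem Sg.sigmaOne {B : Set M} {R : M → Prop} (hR : Sg B (fun p : PUnit.{u + 1} × M => R p.2)) :
    SigmaOne B {x | R x} := by
  obtain ⟨S, hS, h⟩ := hR.out
  obtain ⟨φ, p, hφ⟩ := hS.out
  -- The witness `y` moves from slot `2` to slot `1`, as `SigmaOne` demands; the parameters make
  -- room by moving from `2j + 1` to `2j + 3`.
  let g : ℕ → ℕ := fun k => if k % 2 = 0 then (if k = 2 then 1 else k) else k + 2
  have hg : Function.Injective g := by
    intro a b hab
    simp only [g] at hab
    split_ifs at hab <;> omega
  refine ⟨φ.rename g, fun k => if k % 2 = 0 then 0 else p ((k - 3) / 2), fun x => ?_⟩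
  refine (h (PUnit.unit, x)).trans (exists_congr fun y => ?_)
  rw [hφ, BddFormula.holds_rename hg]
  have : mix (Ctx.env ((PUnit.unit, x), y)) p = Function.update (Function.update
      (fun k => if k % 2 = 0 then 0 else p ((k - 3) / 2)) 0 x) 1 y ∘ g := by
    ext k
    rcases Nat.even_or_odd' k with ⟨j, rfl | rfl⟩
    · rw [mix_even]
      by_cases h1 : j = 1
      · subst h1; rfl
      · have e : g (2 * j) = 2 * j := by simp [g, h1]
        have h1' : j ≠ Ctx.size M (PUnit.{u + 1} × M) := h1
        rw [Function.comp_apply, e, env_prod, env_prod,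
          Function.update_of_ne h1', Function.update_of_ne (show 2 * j ≠ 1 by omega)]
        by_cases h0 : j = 0
        · subst h0; rfl
        · rw [Function.update_of_ne (by exact h0), Function.update_of_ne (by omega), if_pos (by omega)]
          rfl
    · have e : g (2 * j + 1) = 2 * j + 3 := by simp only [g]; rw [if_neg (by omega)]
      rw [Function.comp_apply, e, mix_odd, Function.update_of_ne (by omega),
        Function.update_of_ne (by omega), if_neg (by omega)]
      congr 1
      omega
  rw [this]

theorem SigmaOne.sg {S : Set M} (hS : SigmaOne B S) :
    Sg B (fun p : PUnit.{u + 1} × M => p.2 ∈ S) := by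
  obtain ⟨φ, v, h⟩ := hS
  refine ⟨fun p => φ.Holds B (Function.update (Function.update v 0 p.1.2) 1 p.2), ?_,
    fun x => h x.2⟩
  refine φ.bdd_holds B fun i => ?_
  by_cases h1 : i = 1
  · subst h1; simpa using Tm.snd
  · simp only [Function.update_of_ne h1]
    by_cases h0 : i = 0
    · subst h0; simp only [Function.update_self]; infer_instance
    · simp only [Function.update_of_ne h0]; infer_instance

theorem ISig.induct [hB : ISig B] {R : M → Prop}
    (hR : Sg B (fun p : PUnit.{u + 1} × M => R p.2)) (h0 : R 0) (hs : ∀ x, R x → R (x + 1))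
    (x : M) : R x :=
  hB.induction {x | R x} hR.sigmaOne h0 hs x

/-- Induction up to a bound. -/
theorem ISig.induct_le [hB : ISig B] {R : M → Prop}
    (hR : Sg B (fun p : PUnit.{u + 1} × M => R p.2)) (n : M) (h0 : R 0)
    (hs : ∀ x < n, R x → R (x + 1)) : R n := by
  have hR' := hR.comp (fun p : PUnit.{u + 1} × M => p)
  have := ISig.induct B (R := fun x => x ≤ n → R x) (by infer_instance) (fun _ => h0)
    (fun x ih hx => hs x (succ_le_iff.1 hx) (ih ((lt_succ_self x).le.trans hx))) n
  exact this le_rfl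

/-- Collection: a bounded quantifier can be moved behind an unbounded existential one. -/
theorem ISig.collection [hB : ISig B] {R : M → M → Prop}
    (hR : Bdd B (fun p : (PUnit.{u + 1} × M) × M => R p.1.2 p.2)) (n : M)
    (h : ∀ a < n, ∃ y, R a y) : ∃ s, ∀ a < n, ∃ y ≤ s, R a y := by
  have := hR.comp (fun p : (((PUnit.{u + 1} × M) × M) × M) × M => ((p.1.1.1.1, p.1.2), p.2))
  refine ISig.induct_le B (R := fun k => ∃ s, ∀ a < k, ∃ y ≤ s, R a y) inferInstance n
    ⟨0, fun a ha => absurd ha (not_lt.2 zero_le)⟩ ?_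
  rintro k hk ⟨s, hs⟩
  obtain ⟨y, hy⟩ := h k hk
  refine ⟨max s y, fun a ha => ?_⟩
  rcases lt_succ_cases ha with ha | rfl
  · obtain ⟨z, hz, hz'⟩ := hs a ha
    exact ⟨z, hz.trans (le_max_left _ _), hz'⟩
  · exact ⟨y, le_max_right _ _, hy⟩

/-- Collection gives one bound for the witnesses of all `a < t x`, and the quantifier over this
bound comes first. -/
instance Sg.ball [hB : ISig B] (t : X → M) (R : X → M → Prop) [ht : Tm t]
    [hR : Sg B (fun p : X × M => R p.1 p.2)] : Sg B (fun x => ∀ a, a < t x → R x a) := by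
  obtain ⟨S, hS, h⟩ := hR.out
  have := hS.comp (fun p : ((X × M) × M) × M => ((p.1.1.1, p.1.2), p.2))
  have : Tm (fun p : X × M => t p.1) := ht.lift
  refine (inferInstance : Sg B (fun x => ∃ s, ∀ a, a < t x → ∃ y, y ≤ s ∧ S ((x, a), y))).congr
    fun x => ⟨fun hx => ?_, ?_⟩
  · have := hS.comp (fun p : (PUnit.{u + 1} × M) × M => ((x, p.1.2), p.2))
    exact ISig.collection B (R := fun a y => S ((x, a), y)) this (t x)
      fun a ha => (h (x, a)).1 (hx a ha)
  · rintro ⟨s, hs⟩ a ha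
    obtain ⟨y, -, hy⟩ := hs a ha
    exact (h (x, a)).2 ⟨y, hy⟩

/-- Course-of-values induction. -/
theorem ISig.strong_induct [hB : ISig B] {R : M → Prop}
    (hR : Sg B (fun p : PUnit.{u + 1} × M => R p.2)) (hs : ∀ x, (∀ y < x, R y) → R x) (x : M) :
    R x := by
  have := hR.comp (fun p : (PUnit.{u + 1} × M) × M => (p.1.1, p.2))
  have key := ISig.induct B (R := fun x => ∀ y < x, R y) (by infer_instance)
    (fun y hy => absurd hy (not_lt.2 zero_le))
    (fun x ih y hy => by
      rcases lt_succ_cases hy with hy | rfl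
      · exact ih y hy
      · exact hs y ih)
  exact key (x + 1) x (lt_succ_self x)

/-- The least number principle for bounded formulas. -/
theorem ISig.exists_least [hB : ISig B] {R : M → Prop}
    (hR : Bdd B (fun p : PUnit.{u + 1} × M => R p.2)) (h : ∃ x, R x) :
    ∃ x, R x ∧ ∀ y < x, ¬ R y := by
  by_contra hn
  push Not at hn
  obtain ⟨x, hx⟩ := h
  refine ISig.strong_induct B (R := fun x => ¬ R x) (by infer_instance) (fun x ih hx => ?_) x hx
  obtain ⟨y, hy, hy'⟩ := hn x hx
  exact ih y hy hy'

/-- Induction up to a bound for complements of `Σ₁` sets. -/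
theorem ISig.pi_induct_le [hB : ISig B] {R : M → Prop}
    (hR : Sg B (fun p : PUnit.{u + 1} × M => R p.2)) (n : M) (h0 : ¬ R 0)
    (hs : ∀ x < n, ¬ R x → ¬ R (x + 1)) : ¬ R n := by
  intro hn
  have := hR.comp (fun p : (PUnit.{u + 1} × M) × M => (p.1.1, p.2))
  -- Counting down from `n`: by the contrapositive of `hs`, truth of `R` at `n` would spread down to
  -- `0`.
  obtain ⟨k, hk, hk'⟩ := ISig.induct_le B (R := fun j => ∃ k, k + j = n ∧ R k) inferInstance n
    ⟨n, add_zero n, hn⟩ (by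
      rintro j hj ⟨k, hk, hRk⟩
      rcases eq_zero_or_succ k with rfl | ⟨k, rfl⟩
      · exact absurd hRk h0
      · refine ⟨k, by rw [← hk]; ring, ?_⟩
        by_contra hc
        refine hs k ?_ hc hRk
        rw [← succ_le_iff, ← hk]
        exact le_add_of_nonneg_right zero_le)
  have : k = 0 := by
    apply add_right_cancel (b := n)
    rw [hk, zero_add]
  exact h0 (this ▸ hk')

/-- The greatest element of a bounded `Σ₁` set. -/
theorem ISig.exists_greatest [hB : ISig B] {R : M → Prop}
    (hR : Sg B (fun p : PUnit.{u + 1} × M => R p.2)) (h0 : R 0) {n : M} (hn : ¬ R n) :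
    ∃ x, R x ∧ ¬ R (x + 1) := by
  by_contra hc
  push Not at hc
  exact hn (ISig.induct B hR h0 hc n)

/-- The formula and its negation are treated together, since negation exchanges the two claims. The
universal bounded quantifiers use collection. -/
theorem BddFormula.sg_holds [hB : ISig B] {Z : Set M}
    (hZ : Sg B (fun p : PUnit.{u + 1} × M => p.2 ∈ Z))
    (hZ' : Sg B (fun p : PUnit.{u + 1} × M => p.2 ∉ Z)) (φ : BddFormula) {X : Type u} [Ctx M X]
    {k : X → ℕ → M} (hk : ∀ i, Tm (fun x => k x i)) :
    Sg B (fun x => φ.Holds Z (k x)) ∧ Sg B (fun x => ¬ φ.Holds Z (k x)) := by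
  induction φ generalizing X with
  | eq s t =>
    have := s.tm_val hk; have := t.tm_val hk
    constructor <;> (simp only [Holds]; infer_instance)
  | lt s t =>
    have := s.tm_val hk; have := t.tm_val hk
    constructor <;> (simp only [Holds]; infer_instance)
  | mem t =>
    have := t.tm_val hk
    exact ⟨hZ.comp (fun x => (PUnit.unit, t.val (k x))),
      hZ'.comp (fun x => (PUnit.unit, t.val (k x)))⟩
  | not φ h =>
    obtain ⟨h1, h2⟩ := h hk
    simp only [Holds, not_not]
    exact ⟨h2, h1⟩
  | and φ ψ h h' =>
    obtain ⟨h1, h2⟩ := h hk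
    obtain ⟨h3, h4⟩ := h' hk
    simp only [Holds, not_and_or]
    exact ⟨Sg.and _ _ _, Sg.or _ _ _⟩
  | or φ ψ h h' =>
    obtain ⟨h1, h2⟩ := h hk
    obtain ⟨h3, h4⟩ := h' hk
    simp only [Holds, not_or]
    exact ⟨Sg.or _ _ _, Sg.and _ _ _⟩
  | ball i t φ h =>
    have := t.tm_val hk
    have := this.lift
    obtain ⟨h1, h2⟩ := h (tm_update hk i)
    simp only [Holds, not_forall, exists_prop]
    exact ⟨Sg.ball B _ (fun x a => φ.Holds Z (Function.update (k x) i a)),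
      Sg.ex B (fun x a => a < t.val (k x) ∧ ¬ φ.Holds Z (Function.update (k x) i a))⟩
  | bex i t φ h =>
    have := t.tm_val hk
    have := this.lift
    obtain ⟨h1, h2⟩ := h (tm_update hk i)
    simp only [Holds, not_exists, not_and]
    exact ⟨Sg.ex B (fun x a => a < t.val (k x) ∧ φ.Holds Z (Function.update (k x) i a)),
      Sg.ball B _ (fun x a => ¬ φ.Holds Z (Function.update (k x) i a))⟩

/-- `Σ₁` induction relative to `B` yields `Σ₁` induction relative to sets that are `Δ₁` in `B`. -/
theorem ISig.of_delta [hB : ISig B] {Z : Set M}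
    (hZ : Sg B (fun p : PUnit.{u + 1} × M => p.2 ∈ Z))
    (hZ' : Sg B (fun p : PUnit.{u + 1} × M => p.2 ∉ Z)) : ISig Z := by
  refine ⟨fun S hS => ?_⟩
  refine hB.induction S ?_
  obtain ⟨R, hR, h⟩ := (SigmaOne.sg Z hS).out
  obtain ⟨φ, p, hφ⟩ := hR.out
  have : Sg B (fun p : PUnit.{u + 1} × M => p.2 ∈ S) := by
    have := (φ.sg_holds B hZ hZ'
      ((TmMap.id (M := M) (X := (PUnit.{u + 1} × M) × M)).mix p)).1
    refine (Sg.ex B (fun x a => R (x, a)) (hR := ?_)).congr h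
    exact this.congr hφ
  exact this.sigmaOne

theorem ISig.of_bdd [hB : ISig B] {Z : Set M}
    (hZ : Bdd B (fun p : PUnit.{u + 1} × M => p.2 ∈ Z)) : ISig Z :=
  ISig.of_delta B inferInstance (by infer_instance)

theorem ISig.empty [hB : ISig B] : ISig (∅ : Set M) :=
  ISig.of_bdd B (by simp only [Set.mem_empty_iff_false]; infer_instance)

end SigmaOneRelations

/-! ### Coded finite sets -/

section FiniteSets

variable {M : Type u} [CommSemiring M] [LinearOrder M] [PMinus M] {X : Type u} [Ctx M X]
  {Y : Type u} [Ctx M Y] (B : Set M)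

theorem dvd_iff_bounded (a b : M) : a ∣ b ↔ ∃ q ≤ b, b = a * q := by
  constructor
  · rintro ⟨q, rfl⟩
    rcases eq_or_ne a 0 with rfl | ha
    · exact ⟨0, zero_le, by simp⟩
    · exact ⟨q, (le_mul_of_pos (pos_of_ne_zero' ha)).trans_eq (mul_comm _ _), rfl⟩
  · rintro ⟨q, -, h⟩
    exact ⟨q, h⟩

instance Bdd.dvd (f g : X → M) [hf : Tm f] [hg : Tm g] : Bdd B (fun x => f x ∣ g x) := by
  have h : Bdd B (fun p : (PUnit.{u + 1} × M) × M => p.1.2 ∣ p.2) := by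
    simp only [dvd_iff_bounded]; infer_instance
  exact h.comp (fun x => ((PUnit.unit, f x), g x))

theorem memCode_iff_bounded (x c : M) : MemCode x c ↔ ∃ n ≤ c, ∃ a ≤ c, ∃ b ≤ c,
    c = pair n (pair a b) ∧ x < n ∧ (1 + (x + 1) * b) ∣ a := by
  constructor
  · rintro ⟨n, a, b, rfl, h⟩
    have h1 := right_le_pair n (pair a b)
    exact ⟨n, left_le_pair _ _, a, (left_le_pair a b).trans h1, b, (right_le_pair a b).trans h1,
      rfl, h⟩
  · rintro ⟨n, -, a, -, b, -, h⟩
    exact ⟨n, a, b, h⟩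

instance Bdd.memCode (f g : X → M) [hf : Tm f] [hg : Tm g] :
    Bdd B (fun x => MemCode (f x) (g x)) := by
  have h : Bdd B (fun p : (PUnit.{u + 1} × M) × M => MemCode p.1.2 p.2) := by
    simp only [memCode_iff_bounded]; infer_instance
  exact h.comp (fun x => ((PUnit.unit, f x), g x))

theorem memCode_pair {n a b x : M} :
    MemCode x (pair n (pair a b)) ↔ x < n ∧ modulus b x ∣ a := by
  constructor
  · rintro ⟨n', a', b', h, h'⟩
    simp only [pair_eq_pair] at h
    obtain ⟨rfl, rfl, rfl⟩ := h
    exact h'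
  · exact fun h => ⟨n, a, b, rfl, h⟩

/-- A witness that every bounded `Σ₁` set of numbers below `n` has a code below `w`. -/
def SubsetBound (n w : M) : Prop :=
  ∃ b ≤ w, ∃ P ≤ w, pair n (pair P b) < w ∧ 0 < b ∧ (∀ i < n, i + 1 ∣ b) ∧ 0 < P ∧
    ∀ x < n, 1 + (x + 1) * b ∣ P

instance Bdd.subsetBound (f g : X → M) [hf : Tm f] [hg : Tm g] :
    Bdd B (fun x => SubsetBound (f x) (g x)) := by
  have h : Bdd B (fun p : (PUnit.{u + 1} × M) × M => SubsetBound p.1.2 p.2) := by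
    unfold SubsetBound; infer_instance
  exact h.comp (fun x => ((PUnit.unit, f x), g x))

theorem exists_common_multiple [hB : ISig B] (c n : M) :
    ∃ b > 0, ∀ i < n, 1 + (i + 1) * c ∣ b := by
  refine ISig.induct B (R := fun n => ∃ b, 0 < b ∧ ∀ i < n, 1 + (i + 1) * c ∣ b) (by infer_instance)
    ⟨1, zero_lt_one, fun i hi => absurd hi (not_lt.2 zero_le)⟩ ?_ n
  rintro n ⟨b, hb, h⟩
  refine ⟨b * (1 + (n + 1) * c), mul_pos hb (add_pos_of_pos_of_nonneg zero_lt_one zero_le),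
    fun i hi => ?_⟩
  rcases lt_succ_cases hi with hi | rfl
  · exact (h i hi).mul_right _
  · exact dvd_mul_left _ _

/-- All subsets are coded with the same `b`, and with first components that divide the common
multiple `P` of the moduli. So one bound serves all of them, whichever oracle defines them. -/
theorem exists_subsetBound [hB : ISig B] (n : M) : ∃ w, SubsetBound n w := by
  obtain ⟨b, hb, hbn⟩ : ∃ b > 0, ∀ i < n, i + 1 ∣ b := by
    obtain ⟨b, hb, h⟩ := exists_common_multiple B 1 n
    refine ISig.induct B (R := fun n => ∃ b, 0 < b ∧ ∀ i < n, i + 1 ∣ b) (by infer_instance)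
      ⟨1, zero_lt_one, fun i hi => absurd hi (not_lt.2 zero_le)⟩ ?_ n
    rintro n ⟨b, hb, h⟩
    refine ⟨b * (n + 1), mul_pos hb (lt_of_le_of_lt zero_le (lt_succ_self n)), fun i hi => ?_⟩
    rcases lt_succ_cases hi with hi | rfl
    · exact (h i hi).mul_right _
    · exact dvd_mul_left _ _
  obtain ⟨P, hP, hPn⟩ := exists_common_multiple B b n
  have h1 := right_le_pair n (pair P b)
  exact ⟨pair n (pair P b) + 1, b, ((right_le_pair P b).trans h1).trans (lt_succ_self _).le, P,
    ((left_le_pair P b).trans h1).trans (lt_succ_self _).le, lt_succ_self _, hb, hbn, hP, hPn⟩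

/-- Bounded `Σ₁` comprehension. -/
theorem exists_code [hB : ISig B] {n w : M} (hw : SubsetBound n w) {R : M → Prop}
    (hR : Sg B (fun p : PUnit.{u + 1} × M => R p.2)) :
    ∃ c < w, ∀ x, MemCode x c ↔ x < n ∧ R x := by
  obtain ⟨b, -, P, -, hlt, hb, hbn, hP, hPn⟩ := hw
  -- A factorization of `P` sorts every modulus into `a'` or into `q`, and only moduli of elements
  -- of `R` may divide `a'`. A factorization with maximal `a'` collects all of them. The clause `a ≤
  -- a'` closes `S` downwards, so that a failure at the successor means maximality.
  let S : M → Prop := fun a => ∃ a', a ≤ a' ∧ ∃ q, a' * q = P ∧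
    (∀ x < n, 1 + (x + 1) * b ∣ a' ∨ 1 + (x + 1) * b ∣ q) ∧
    ∀ x < n, 1 + (x + 1) * b ∣ a' → R x
  have hle : ∀ a q, a * q = P → a ≤ P := by
    rintro a q rfl
    refine le_mul_of_pos (pos_of_ne_zero' ?_)
    rintro rfl
    simp at hP
  have hS0 : S 0 := ⟨1, zero_le, P, one_mul P, fun x hx => Or.inr (hPn x hx),
    fun x _ h => absurd h (not_modulus_dvd_one hb)⟩
  have hSP : ¬ S (P + 1) := by
    rintro ⟨a', ha', q, hq, -⟩
    exact absurd (ha'.trans (hle a' q hq)) (not_le.2 (lt_succ_self P))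
  have := hR.comp (fun p : (((PUnit.{u + 1} × M) × M) × M) × M => (p.1.1.1.1, p.2))
  obtain ⟨a₀, ⟨a, ha, q, hq, hor, hRa⟩, hmax⟩ :=
    ISig.exists_greatest B (R := S) (by simp only [S]; infer_instance) hS0 hSP
  refine ⟨pair n (pair a b), lt_of_le_of_lt (pair_le_pair le_rfl
    (pair_le_pair (hle a q hq) le_rfl)) hlt, fun x => ?_⟩
  rw [memCode_pair]
  refine and_congr_right fun hx => ⟨hRa x hx, fun hRx => ?_⟩
  by_contra hdvd
  obtain ⟨q', rfl⟩ := (hor x hx).resolve_left hdvd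
  -- An element `x` of `R` that was left out has its modulus in the cofactor; moving it over gives a
  -- larger first factor.
  refine hmax ⟨a * modulus b x, ?_, q', by rw [← hq]; ring, fun z hz => ?_, fun z hz h => ?_⟩
  · have ha1 : 0 < a := pos_of_ne_zero' (by rintro rfl; simp at hdvd)
    have hm : 1 < modulus b x := by
      have : 0 < (x + 1) * b := mul_pos (lt_of_le_of_lt zero_le (lt_succ_self x)) hb
      exact lt_add_of_pos_right 1 this
    have h2 : a < a * modulus b x := by
      calc a = a * 1 := (mul_one a).symm
        _ < a * modulus b x := mul_lt_mul_of_pos_left hm ha1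
    exact succ_le_iff.2 (lt_of_le_of_lt ha h2)
  · rcases eq_or_ne z x with rfl | hne
    · exact Or.inl (dvd_mul_left _ _)
    · rcases hor z hz with h | h
      · exact Or.inl (h.mul_right _)
      · rw [mul_comm _ q'] at h
        exact Or.inr (modulus_dvd_of_dvd_mul hbn hz hx hne h)
  · rcases eq_or_ne z x with rfl | hne
    · exact hRx
    · exact hRa z hz (modulus_dvd_of_dvd_mul hbn hz hx hne h)

theorem exists_code' [hB : ISig B] (n : M) {R : M → Prop}
    (hR : Sg B (fun p : PUnit.{u + 1} × M => R p.2)) :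
    ∃ c, ∀ x, MemCode x c ↔ x < n ∧ R x := by
  obtain ⟨w, hw⟩ := exists_subsetBound B n
  obtain ⟨c, -, hc⟩ := exists_code B hw hR
  exact ⟨c, hc⟩

theorem exists_code_union [hB : ISig B] (c d : M) :
    ∃ e, ∀ x, MemCode x e ↔ MemCode x c ∨ MemCode x d := by
  obtain ⟨e, he⟩ := exists_code' B (c + d) (R := fun x => MemCode x c ∨ MemCode x d) (by infer_instance)
  refine ⟨e, fun x => (he x).trans (and_iff_right_of_imp ?_)⟩
  rintro (h | h)
  · exact h.lt.trans_le (le_add_of_nonneg_right zero_le)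
  · exact h.lt.trans_le (le_add_of_nonneg_left zero_le)

theorem exists_code_singleton [hB : ISig B] (a : M) : ∃ e, ∀ x, MemCode x e ↔ x = a := by
  obtain ⟨e, he⟩ := exists_code' B (a + 1) (R := fun x => x = a) (by infer_instance)
  refine ⟨e, fun x => (he x).trans (and_iff_right_of_imp ?_)⟩
  rintro rfl
  exact lt_succ_self x

end FiniteSets

/-! ### Computations -/

section Computations

variable {M : Type u} [CommSemiring M] [LinearOrder M] [PMinus M] {X : Type u} [Ctx M X]
  {Y : Type u} [Ctx M Y] {B B' U D D' : Set M}

open Classical in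
/-- The characteristic function of a proposition. -/
noncomputable def char (M : Type u) [CommSemiring M] (p : Prop) : M := if p then 1 else 0

theorem char_eq_zero {p : Prop} : char M p = 0 ↔ ¬ p := by
  unfold char; split_ifs <;> simp_all

theorem char_eq_one {p : Prop} : char M p = 1 ↔ p := by
  unfold char; split_ifs <;> simp_all

theorem lt_pair_of_pos {a b : M} (h : 0 < a) : b < pair a b :=
  (lt_add_of_pos_left b h).trans_le (add_le_pair a b)

theorem Justified.mono {c x y : M} (h : Justified B D c x y) (hD : D ⊆ D') :
    Justified B D' c x y := by
  cases h with
  | const => exact .const _ _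
  | id => exact .id _
  | left => exact .left _ _
  | right => exact .right _ _
  | add => exact .add _ _
  | mul => exact .mul _ _
  | lt_true _ _ h => exact .lt_true _ _ h
  | lt_false _ _ h => exact .lt_false _ _ h
  | oracle_true _ h => exact .oracle_true _ h
  | oracle_false _ h => exact .oracle_false _ h
  | pairing f g x u w h h' => exact .pairing _ _ _ _ _ (hD h) (hD h')
  | comp f g x u y h h' => exact .comp _ _ _ _ _ (hD h) (hD h')
  | search f x y h h' =>
    refine .search _ _ _ (hD h) fun z hz => ?_
    obtain ⟨w, hw, h⟩ := h' z hz
    exact ⟨w, hw, hD h⟩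

theorem Justified.congr_oracle {c x y : M} (h : Justified B D c x y)
    (hB : c = pair 1 6 → (x ∈ B ↔ x ∈ B')) : Justified B' D c x y := by
  cases h with
  | const => exact .const _ _
  | id => exact .id _
  | left => exact .left _ _
  | right => exact .right _ _
  | add => exact .add _ _
  | mul => exact .mul _ _
  | lt_true _ _ h => exact .lt_true _ _ h
  | lt_false _ _ h => exact .lt_false _ _ h
  | oracle_true _ h => exact .oracle_true _ ((hB rfl).1 h)
  | oracle_false _ h => exact .oracle_false _ (mt (hB rfl).2 h)
  | pairing f g x u w h h' => exact .pairing _ _ _ _ _ h h'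
  | comp f g x u y h h' => exact .comp _ _ _ _ _ h h'
  | search f x y h h' => exact .search _ _ _ h h'

/-! Inversion of the inductive definition. -/

theorem Justified.const_inv {a x y : M} (h : Justified B D (pair 0 a) x y) : y = a := by
  generalize hc : pair 0 a = c at h
  cases h <;> simp at hc
  exact hc.symm

theorem Justified.id_inv {x y : M} (h : Justified B D (pair 1 0) x y) : y = x := by
  generalize hc : pair (1 : M) 0 = c at h
  cases h <;> simp at hc
  rfl

theorem Justified.left_inv {a b y : M} (h : Justified B D (pair 1 1) (pair a b) y) :
    y = a := by
  generalize hc : pair (1 : M) 1 = c at h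
  generalize hx : pair a b = x at h
  cases h <;> simp at hc
  obtain ⟨rfl, rfl⟩ := pair_inj hx
  rfl

theorem Justified.right_inv {a b y : M} (h : Justified B D (pair 1 2) (pair a b) y) :
    y = b := by
  generalize hc : pair (1 : M) 2 = c at h
  generalize hx : pair a b = x at h
  cases h <;> simp at hc
  obtain ⟨rfl, rfl⟩ := pair_inj hx
  rfl

theorem Justified.add_inv {a b y : M} (h : Justified B D (pair 1 3) (pair a b) y) :
    y = a + b := by
  generalize hc : pair (1 : M) 3 = c at h
  generalize hx : pair a b = x at h
  cases h <;> simp at hc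
  obtain ⟨rfl, rfl⟩ := pair_inj hx
  rfl

theorem Justified.mul_inv {a b y : M} (h : Justified B D (pair 1 4) (pair a b) y) :
    y = a * b := by
  generalize hc : pair (1 : M) 4 = c at h
  generalize hx : pair a b = x at h
  cases h <;> simp at hc
  obtain ⟨rfl, rfl⟩ := pair_inj hx
  rfl

theorem Justified.lt_inv {a b y : M} (h : Justified B D (pair 1 5) (pair a b) y) :
    (a < b ∧ y = 1) ∨ (¬ a < b ∧ y = 0) := by
  generalize hc : pair (1 : M) 5 = c at h
  generalize hx : pair a b = x at h
  cases h <;> simp at hc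
  all_goals
    obtain ⟨rfl, rfl⟩ := pair_inj hx
    simp_all

theorem Justified.oracle_inv {x y : M} (h : Justified B D (pair 1 6) x y) :
    (x ∈ B ∧ y = 1) ∨ (x ∉ B ∧ y = 0) := by
  generalize hc : pair (1 : M) 6 = c at h
  cases h <;> simp at hc <;> simp_all

theorem Justified.pairing_inv {f g x y : M} (h : Justified B D (pair 2 (pair f g)) x y) :
    ∃ u w, y = pair u w ∧ pair f (pair x u) ∈ D ∧ pair g (pair x w) ∈ D := by
  generalize hc : pair 2 (pair f g) = c at h
  cases h <;> simp at hc
  obtain ⟨rfl, rfl⟩ := hc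
  exact ⟨_, _, rfl, ‹_›, ‹_›⟩

theorem Justified.comp_inv {f g x y : M} (h : Justified B D (pair 3 (pair f g)) x y) :
    ∃ u, pair g (pair x u) ∈ D ∧ pair f (pair u y) ∈ D := by
  generalize hc : pair 3 (pair f g) = c at h
  cases h <;> simp at hc
  obtain ⟨rfl, rfl⟩ := hc
  exact ⟨_, ‹_›, ‹_›⟩

theorem Justified.search_inv {f x y : M} (h : Justified B D (pair 4 f) x y) :
    pair f (pair (pair x y) 0) ∈ D ∧
      ∀ z : M, z < y → ∃ w : M, w ≠ 0 ∧ pair f (pair (pair x z) w) ∈ D := by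
  generalize hc : pair 4 f = c at h
  cases h <;> simp at hc
  subst hc
  exact ⟨‹_›, ‹_›⟩

/-- `d` codes a set of values that is closed under justifications with the oracle `B` and
contains oracle queries in `U` only. -/
def Closed (B U : Set M) (d : M) : Prop :=
  ∀ c x y : M, MemCode (pair c (pair x y)) d →
    Justified B {p | MemCode p d} c x y ∧ (c = pair 1 6 → x ∈ U)

/-- `Φ_e^B(x) = y` by a computation whose oracle queries are in `U`. -/
def PhiUse (B U : Set M) (e x y : M) : Prop :=
  ∃ d : M, MemCode (pair e (pair x y)) d ∧ Closed B U d

theorem Closed.isComputation {d e x y : M} (hd : Closed B U d)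
    (h : MemCode (pair e (pair x y)) d) : IsComputation B e x y d :=
  ⟨h, fun c x y hc => (hd c x y hc).1⟩

theorem IsComputation.closed {d e x y : M} (h : IsComputation B e x y d) :
    Closed B Set.univ d :=
  fun c x y hc => ⟨h.2 c x y hc, fun _ => Set.mem_univ _⟩

theorem PhiUse.phi {e x y : M} (h : PhiUse B U e x y) : Phi B e x y := by
  obtain ⟨d, h, hd⟩ := h
  exact ⟨d, hd.isComputation h⟩

theorem phi_iff {e x y : M} : Phi B e x y ↔ PhiUse B Set.univ e x y :=
  ⟨fun ⟨d, h⟩ => ⟨d, h.1, h.closed⟩, PhiUse.phi⟩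

theorem Closed.congr_oracle {d : M} (hd : Closed B U d) (h : ∀ q ∈ U, q ∈ B ↔ q ∈ B') :
    Closed B' U d := fun c x y hc =>
  ⟨(hd c x y hc).1.congr_oracle fun hc' => h x ((hd c x y hc).2 hc'), (hd c x y hc).2⟩

theorem PhiUse.congr_oracle {e x y : M} (h : PhiUse B U e x y) (hB : ∀ q ∈ U, q ∈ B ↔ q ∈ B') :
    PhiUse B' U e x y := by
  obtain ⟨d, h, hd⟩ := h
  exact ⟨d, h, hd.congr_oracle hB⟩

theorem entry_lt {c x y d : M} (h : MemCode (pair c (pair x y)) d) : c < d ∧ x < d ∧ y < d :=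
  ⟨(left_le_pair _ _).trans_lt h.lt,
    ((left_le_pair _ _).trans (right_le_pair c _)).trans_lt h.lt,
    ((right_le_pair _ _).trans (right_le_pair c _)).trans_lt h.lt⟩

/-- A computation with code `d` only queries the oracle below `d`. -/
theorem IsComputation.congr_oracle {d e x y : M} (h : IsComputation B e x y d)
    (hB : ∀ q < d, q ∈ B ↔ q ∈ B') : IsComputation B' e x y d :=
  ⟨h.1, fun c x y hc => (h.2 c x y hc).congr_oracle fun _ => hB x (entry_lt hc).2.1⟩

/-! Construction of computations. -/

theorem closed_zero : Closed B U (0 : M) := fun _ _ _ h => absurd h.lt (not_lt.2 zero_le)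

/-- Justifications use the set of known values only positively, so computations can be joined
freely. -/
theorem Closed.union [hB : ISig B] {c d : M} (hc : Closed B U c) (hd : Closed B U d) :
    ∃ e, Closed B U e ∧ (∀ p, MemCode p c → MemCode p e) ∧ ∀ p, MemCode p d → MemCode p e := by
  obtain ⟨e, he⟩ := exists_code_union B c d
  have h1 : ∀ p, MemCode p c → MemCode p e := fun p h => (he p).2 (Or.inl h)
  have h2 : ∀ p, MemCode p d → MemCode p e := fun p h => (he p).2 (Or.inr h)
  refine ⟨e, fun i x y h => ?_, h1, h2⟩
  rcases (he _).1 h with h | h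
  · exact ⟨(hc i x y h).1.mono h1, (hc i x y h).2⟩
  · exact ⟨(hd i x y h).1.mono h2, (hd i x y h).2⟩

theorem Closed.insert [hB : ISig B] {d c x y : M} (hd : Closed B U d)
    (hj : Justified B {p | MemCode p d} c x y) (hU : c = pair 1 6 → x ∈ U) :
    ∃ e, Closed B U e ∧ (∀ p, MemCode p d → MemCode p e) ∧ MemCode (pair c (pair x y)) e := by
  obtain ⟨s, hs⟩ := exists_code_singleton B (pair c (pair x y))
  obtain ⟨e, he⟩ := exists_code_union B d s
  have h1 : ∀ p, MemCode p d → MemCode p e := fun p h => (he p).2 (Or.inl h)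
  refine ⟨e, fun i x' y' h => ?_, h1, (he _).2 (Or.inr ((hs _).2 rfl))⟩
  rcases (he _).1 h with h | h
  · exact ⟨(hd i x' y' h).1.mono h1, (hd i x' y' h).2⟩
  · have h' := (hs _).1 h
    simp only [pair_eq_pair] at h'
    obtain ⟨rfl, rfl, rfl⟩ := h'
    exact ⟨hj.mono h1, hU⟩

theorem PhiUse.of_justified [hB : ISig B] {c x y : M} (hc : c ≠ pair 1 6)
    (h : ∀ D, Justified B D c x y) : PhiUse B U c x y := by
  obtain ⟨e, he, -, h⟩ := closed_zero.insert (U := U) (h _) fun h => absurd h hc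
  exact ⟨e, h, he⟩

theorem PhiUse.const [hB : ISig B] (a x : M) : PhiUse B U (pair 0 a) x a :=
  .of_justified (by simp) fun _ => .const a x

theorem PhiUse.id [hB : ISig B] (x : M) : PhiUse B U (pair 1 0) x x :=
  .of_justified (by simp) fun _ => .id x

theorem PhiUse.left [hB : ISig B] (a b : M) : PhiUse B U (pair 1 1) (pair a b) a :=
  .of_justified (by simp) fun _ => .left a b

theorem PhiUse.right [hB : ISig B] (a b : M) : PhiUse B U (pair 1 2) (pair a b) b :=
  .of_justified (by simp) fun _ => .right a b

theorem PhiUse.add [hB : ISig B] (a b : M) : PhiUse B U (pair 1 3) (pair a b) (a + b) :=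
  .of_justified (by simp) fun _ => .add a b

theorem PhiUse.mul [hB : ISig B] (a b : M) : PhiUse B U (pair 1 4) (pair a b) (a * b) :=
  .of_justified (by simp) fun _ => .mul a b

theorem PhiUse.lt [hB : ISig B] (a b : M) :
    PhiUse B U (pair 1 5) (pair a b) (char M (a < b)) :=
  .of_justified (by simp) fun _ => by
    unfold char
    split_ifs with h
    · exact .lt_true a b h
    · exact .lt_false a b h

theorem PhiUse.oracle [hB : ISig B] {x : M} (hx : x ∈ U) :
    PhiUse B U (pair 1 6) x (char M (x ∈ B)) := by
  obtain ⟨e, he, -, h⟩ := (closed_zero (B := B)).insert (U := U) (x := x)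
    (y := char M (x ∈ B)) (c := pair 1 6) (by
      unfold char
      split_ifs with h
      · exact .oracle_true x h
      · exact .oracle_false x h) fun _ => hx
  exact ⟨e, h, he⟩

theorem PhiUse.pairing [hB : ISig B] {f g x u w : M} (hf : PhiUse B U f x u)
    (hg : PhiUse B U g x w) : PhiUse B U (pair 2 (pair f g)) x (pair u w) := by
  obtain ⟨c, hc, hc'⟩ := hf
  obtain ⟨d, hd, hd'⟩ := hg
  obtain ⟨e, he, h1, h2⟩ := hc'.union hd'
  obtain ⟨e', he', -, h⟩ := he.insert (.pairing f g x u w (h1 _ hc) (h2 _ hd)) (by simp)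
  exact ⟨e', h, he'⟩

theorem PhiUse.comp [hB : ISig B] {f g x u y : M} (hg : PhiUse B U g x u)
    (hf : PhiUse B U f u y) : PhiUse B U (pair 3 (pair f g)) x y := by
  obtain ⟨c, hc, hc'⟩ := hg
  obtain ⟨d, hd, hd'⟩ := hf
  obtain ⟨e, he, h1, h2⟩ := hc'.union hd'
  obtain ⟨e', he', -, h⟩ := he.insert (.comp f g x u y (h1 _ hc) (h2 _ hd)) (by simp)
  exact ⟨e', h, he'⟩

/-! Inversion for computations. -/

theorem PhiUse.comp_inv {f g x y : M} (h : PhiUse B U (pair 3 (pair f g)) x y) :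
    ∃ u, PhiUse B U g x u ∧ PhiUse B U f u y := by
  obtain ⟨d, h, hd⟩ := h
  obtain ⟨u, h1, h2⟩ := (hd _ _ _ h).1.comp_inv
  exact ⟨u, ⟨d, h1, hd⟩, ⟨d, h2, hd⟩⟩

theorem PhiUse.const_inv {a x y : M} (h : PhiUse B U (pair 0 a) x y) : y = a := by
  obtain ⟨d, h, hd⟩ := h
  exact (hd _ _ _ h).1.const_inv

theorem PhiUse.search_inv {f x y : M} (h : PhiUse B U (pair 4 f) x y) :
    PhiUse B U f (pair x y) 0 ∧ ∀ z < y, ∃ w ≠ 0, PhiUse B U f (pair x z) w := by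
  obtain ⟨d, h, hd⟩ := h
  obtain ⟨h1, h2⟩ := (hd _ _ _ h).1.search_inv
  refine ⟨⟨d, h1, hd⟩, fun z hz => ?_⟩
  obtain ⟨w, hw, h⟩ := h2 z hz
  exact ⟨w, hw, d, h, hd⟩

/-! Definability. -/

/-- All data of a justification are components of `c`, of `x` or of elements of the set coded by
`d`. Hence being a computation is a bounded property relative to the oracle. -/
theorem justified_iff_bounded {d c x y : M} : Justified B {p | MemCode p d} c x y ↔
    c = pair 0 y ∨ (c = pair 1 0 ∧ x = y) ∨ (c = pair 1 1 ∧ ∃ b ≤ x, x = pair y b) ∨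
    (c = pair 1 2 ∧ ∃ a ≤ x, x = pair a y) ∨
    (c = pair 1 3 ∧ ∃ a ≤ x, ∃ b ≤ x, x = pair a b ∧ y = a + b) ∨
    (c = pair 1 4 ∧ ∃ a ≤ x, ∃ b ≤ x, x = pair a b ∧ y = a * b) ∨
    (c = pair 1 5 ∧ ∃ a ≤ x, ∃ b ≤ x, x = pair a b ∧ ((a < b ∧ y = 1) ∨ (¬ a < b ∧ y = 0))) ∨
    (c = pair 1 6 ∧ ((x ∈ B ∧ y = 1) ∨ (x ∉ B ∧ y = 0))) ∨
    (∃ f ≤ c, ∃ g ≤ c, c = pair 2 (pair f g) ∧ ∃ u ≤ d, ∃ w ≤ d, y = pair u w ∧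
      MemCode (pair f (pair x u)) d ∧ MemCode (pair g (pair x w)) d) ∨
    (∃ f ≤ c, ∃ g ≤ c, c = pair 3 (pair f g) ∧ ∃ u ≤ d,
      MemCode (pair g (pair x u)) d ∧ MemCode (pair f (pair u y)) d) ∨
    (∃ f ≤ c, c = pair 4 f ∧ MemCode (pair f (pair (pair x y) 0)) d ∧
      ∀ z < y, ∃ w ≤ d, w ≠ 0 ∧ MemCode (pair f (pair (pair x z) w)) d) := by
  constructor
  · intro h
    cases h with
    | const => simp
    | id => simp
    | left a b => simp [right_le_pair]
    | right a b => simp [left_le_pair]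
    | add a b => simp [left_le_pair, right_le_pair]
    | mul a b => simp [left_le_pair, right_le_pair]
    | lt_true a b h => simp [left_le_pair, right_le_pair, h]
    | lt_false a b h => simp [left_le_pair, right_le_pair, not_lt.1 h]
    | oracle_true a h => simp [h]
    | oracle_false a h => simp [h]
    | pairing f g x u w h h' =>
      simp only [Set.mem_ofPred_eq] at h h'
      have h1 := right_le_pair 2 (pair f g)
      iterate 8 right
      left
      exact ⟨f, (left_le_pair f g).trans h1, g, (right_le_pair f g).trans h1, rfl, u,
        (entry_lt h).2.2.le, w, (entry_lt h').2.2.le, rfl, h, h'⟩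
    | comp f g x u y h h' =>
      simp only [Set.mem_ofPred_eq] at h h'
      have h1 := right_le_pair 3 (pair f g)
      iterate 9 right
      left
      exact ⟨f, (left_le_pair f g).trans h1, g, (right_le_pair f g).trans h1, rfl, u,
        (entry_lt h).2.2.le, h, h'⟩
    | search f x y h h' =>
      iterate 10 right
      refine ⟨f, right_le_pair _ _, rfl, h, fun z hz => ?_⟩
      obtain ⟨w, hw, h''⟩ := h' z hz
      exact ⟨w, (entry_lt h'').2.2.le, hw, h''⟩
  · rintro (rfl | ⟨rfl, rfl⟩ | ⟨rfl, b, -, rfl⟩ | ⟨rfl, a, -, rfl⟩ | ⟨rfl, a, -, b, -, rfl, rfl⟩ |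
      ⟨rfl, a, -, b, -, rfl, rfl⟩ | ⟨rfl, a, -, b, -, rfl, ⟨h, rfl⟩ | ⟨h, rfl⟩⟩ |
      ⟨rfl, ⟨h, rfl⟩ | ⟨h, rfl⟩⟩ | ⟨f, -, g, -, rfl, u, -, w, -, rfl, h, h'⟩ |
      ⟨f, -, g, -, rfl, u, -, h, h'⟩ | ⟨f, -, rfl, h, h'⟩)
    · exact .const _ _
    · exact .id _
    · exact .left _ _
    · exact .right _ _
    · exact .add _ _
    · exact .mul _ _
    · exact .lt_true _ _ h
    · exact .lt_false _ _ h
    · exact .oracle_true _ h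
    · exact .oracle_false _ h
    · exact .pairing _ _ _ _ _ h h'
    · exact .comp _ _ _ _ _ h h'
    · refine .search _ _ _ h fun z hz => ?_
      obtain ⟨w, -, hw, h⟩ := h' z hz
      exact ⟨w, hw, h⟩

theorem closed_iff_bounded {d : M} : Closed B U d ↔ ∀ c < d, ∀ x < d, ∀ y < d,
    MemCode (pair c (pair x y)) d →
      Justified B {p | MemCode p d} c x y ∧ (c = pair 1 6 → x ∈ U) :=
  ⟨fun h c _ x _ y _ => h c x y, fun h c x y hc =>
    h c (entry_lt hc).1 x (entry_lt hc).2.1 y (entry_lt hc).2.2 hc⟩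

set_option synthInstance.maxHeartbeats 1000000 in
set_option synthInstance.maxSize 2000 in
theorem Bdd.justified {C : Set M} {O : Y → Set M} (hO : Bdd C (fun p : Y × M => p.2 ∈ O p.1)) :
    Bdd C (fun p : (((Y × M) × M) × M) × M =>
      Justified (O p.1.1.1.1) {q | MemCode q p.1.1.1.2} p.1.1.2 p.1.2 p.2) := by
  have := hO.comp (fun p : (((Y × M) × M) × M) × M => (p.1.1.1.1, p.1.2))
  simp only [justified_iff_bounded]
  infer_instance

theorem Bdd.closed {C : Set M} {O V : Y → Set M} (hO : Bdd C (fun p : Y × M => p.2 ∈ O p.1))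
    (hV : Bdd C (fun p : Y × M => p.2 ∈ V p.1)) :
    Bdd C (fun p : Y × M => Closed (O p.1) (V p.1) p.2) := by
  have := Bdd.justified hO
  have := hV.comp (fun p : (((Y × M) × M) × M) × M => (p.1.1.1.1, p.1.2))
  simp only [closed_iff_bounded]
  infer_instance

/-! Computations have unique values. -/

/-- Induction on the program, since subprograms have smaller codes. The induction formula mentions
only the codes `d` and `d'`, so any `C` with `Σ₁` induction will do, whatever the oracle. -/
theorem Closed.value_unique (C : Set M) [hC : ISig C] {U' : Set M} {d d' : M} (hd : Closed B U d)
    (hd' : Closed B U' d') {c x y y' : M} (h : MemCode (pair c (pair x y)) d)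
    (h' : MemCode (pair c (pair x y')) d') : y = y' := by
  have key := ISig.strong_induct C (R := fun c => ∀ x < d, ∀ y < d, ∀ y' < d',
    MemCode (pair c (pair x y)) d → MemCode (pair c (pair x y')) d' → y = y')
    (by infer_instance) ?_ c
  · exact key x (entry_lt h).2.1 y (entry_lt h).2.2 y' (entry_lt h').2.2 h h'
  clear h h' c x y y'
  intro c ih x _ y _ y' _ h h'
  have ih' : ∀ c' < c, ∀ x y y', MemCode (pair c' (pair x y)) d →
      MemCode (pair c' (pair x y')) d' → y = y' := fun c' hc' x y y' h h' =>
    ih c' hc' x (entry_lt h).2.1 y (entry_lt h).2.2 y' (entry_lt h').2.2 h h'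
  have j := (hd _ _ _ h).1
  have j' := (hd' _ _ _ h').1
  clear h h' ih
  cases j with
  | const a x => exact j'.const_inv.symm
  | id x => exact j'.id_inv.symm
  | left a b => exact j'.left_inv.symm
  | right a b => exact j'.right_inv.symm
  | add a b => exact j'.add_inv.symm
  | mul a b => exact j'.mul_inv.symm
  | lt_true a b hab => exact (j'.lt_inv.resolve_right fun h => h.1 hab).2.symm
  | lt_false a b hab => exact (j'.lt_inv.resolve_left fun h => hab h.1).2.symm
  | oracle_true x hx => rcases j'.oracle_inv with ⟨-, h⟩ | ⟨h, -⟩ <;> simp_all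
  | oracle_false x hx => rcases j'.oracle_inv with ⟨h, -⟩ | ⟨-, h⟩ <;> simp_all
  | pairing f g x u w h1 h2 =>
    obtain ⟨u', w', rfl, h1', h2'⟩ := j'.pairing_inv
    have hlt : pair f g < pair 2 (pair f g) := lt_pair_of_pos zero_lt_two
    rw [ih' f ((left_le_pair f g).trans_lt hlt) _ _ _ h1 h1',
      ih' g ((right_le_pair f g).trans_lt hlt) _ _ _ h2 h2']
  | comp f g x u y h1 h2 =>
    obtain ⟨u', h1', h2'⟩ := j'.comp_inv
    have hlt : pair f g < pair 3 (pair f g) := lt_pair_of_pos zero_lt_three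
    have := ih' g ((right_le_pair f g).trans_lt hlt) _ _ _ h1 h1'
    subst this
    exact ih' f ((left_le_pair f g).trans_lt hlt) _ _ _ h2 h2'
  | search f x y h1 h2 =>
    obtain ⟨h1', h2'⟩ := j'.search_inv
    have hlt : f < pair 4 f := lt_pair_of_pos zero_lt_four
    rcases lt_trichotomy y y' with hy | hy | hy
    · obtain ⟨w, hw, h⟩ := h2' y hy
      exact absurd (ih' f hlt _ _ _ h1 h).symm hw
    · exact hy
    · obtain ⟨w, hw, h⟩ := h2 y' hy
      exact absurd (ih' f hlt _ _ _ h h1') hw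

theorem PhiUse.unique [hB : ISig B] {U' : Set M} {e x y y' : M} (h : PhiUse B U e x y)
    (h' : PhiUse B U' e x y') : y = y' := by
  obtain ⟨d, h, hd⟩ := h
  obtain ⟨d', h', hd'⟩ := h'
  exact hd.value_unique B hd' h h'

/-- Unbounded search terminates if a zero is found and all earlier values are defined. -/
theorem PhiUse.exists_search [hB : ISig B] (hU : Bdd B (fun p : PUnit.{u + 1} × M => p.2 ∈ U))
    {f x a : M} (ha : PhiUse B U f (pair x a) 0)
    (h : ∀ z < a, ∃ w, PhiUse B U f (pair x z) w) : ∃ y, PhiUse B U (pair 4 f) x y := by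
  have := (Bdd.closed (C := B) (O := fun _ : PUnit.{u + 1} => B) (V := fun _ => U)
    (by infer_instance) (hU.comp fun p : PUnit.{u + 1} × M => p)).comp
      (fun p : (PUnit.{u + 1} × M) × M => (PUnit.unit, p.2))
  -- A single computation is extended stepwise: either it already contains a result of the search
  -- below `y`, or it records nonzero values at all arguments below `y`.
  obtain ⟨d, hd, h1 | h1⟩ := ISig.induct_le B (R := fun y => ∃ d, Closed B U d ∧
    ((∃ y' < y, MemCode (pair (pair 4 f) (pair x y')) d) ∨
      ∀ z < y, ∃ w ≤ d, w ≠ 0 ∧ MemCode (pair f (pair (pair x z) w)) d)) (by infer_instance) a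
    ⟨0, closed_zero, Or.inr fun z hz => absurd hz (not_lt.2 zero_le)⟩ (by
      rintro y hy ⟨d, hd, ⟨y', hy', h'⟩ | h'⟩
      · exact ⟨d, hd, Or.inl ⟨y', hy'.trans (lt_succ_self y), h'⟩⟩
      · obtain ⟨w, d', hd', hdc'⟩ := h y hy
        obtain ⟨e, he, h1, h2⟩ := hd.union hdc'
        rcases eq_or_ne w 0 with rfl | hw
        · obtain ⟨e', he', h3, h4⟩ := he.insert (c := pair 4 f) (x := x) (y := y)
            (.search f x y (h2 _ hd') fun z hz => by
              obtain ⟨w, -, hw, h⟩ := h' z hz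
              exact ⟨w, hw, h1 _ h⟩) (by simp)
          exact ⟨e', he', Or.inl ⟨y, lt_succ_self y, h4⟩⟩
        · refine ⟨e, he, Or.inr fun z hz => ?_⟩
          rcases lt_succ_cases hz with hz | rfl
          · obtain ⟨w, -, hw, h⟩ := h' z hz
            exact ⟨w, (entry_lt (h1 _ h)).2.2.le, hw, h1 _ h⟩
          · exact ⟨w, (entry_lt (h2 _ hd')).2.2.le, hw, h2 _ hd'⟩)
  · obtain ⟨y', -, h⟩ := h1
    exact ⟨y', d, h, hd⟩
  · obtain ⟨d', hd', hdc'⟩ := ha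
    obtain ⟨e, he, h2, h3⟩ := hd.union hdc'
    obtain ⟨e', he', -, h4⟩ := he.insert (c := pair 4 f) (x := x) (y := a)
      (.search f x a (h3 _ hd') fun z hz => by
        obtain ⟨w, -, hw, h⟩ := h1 z hz
        exact ⟨w, hw, h2 _ h⟩) (by simp)
    exact ⟨a, e', h4, he'⟩

end Computations

/-! ### Programs for bounded formulas -/

section Programs

variable {M : Type u} [CommSemiring M] [LinearOrder M] [PMinus M]

/-- A family of inputs for programs, each with an oracle and a set of permitted queries. -/
structure Frame (M : Type u) [CommSemiring M] [LinearOrder M] where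
  /-- the index set of the family -/
  carrier : Type u
  /-- the input -/
  code : carrier → M
  /-- the oracle -/
  O : carrier → Set M
  /-- the permitted queries -/
  U : carrier → Set M
  isig : ∀ x, ISig (O x)
  bdd : ∀ x, Bdd (O x) (fun p : PUnit.{u + 1} × M => p.2 ∈ U x)

namespace Frame

variable {F : Frame M}

instance (x : F.carrier) : ISig (F.O x) := F.isig x

/-- Some program computes `f x` from the input attached to `x`. -/
def Cmp (F : Frame M) (f : F.carrier → M) : Prop :=
  ∃ e, ∀ x, PhiUse (F.O x) (F.U x) e (F.code x) (f x)

/-- Some program decides `R x` from the input attached to `x`. -/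
def Dec (F : Frame M) (R : F.carrier → Prop) : Prop := F.Cmp fun x => char M (R x)

/-- The extension of the inputs by an argument `a` with `Q x a`. -/
def ext (F : Frame M) (Q : F.carrier → M → Prop) : Frame M where
  carrier := {p : F.carrier × M // Q p.1 p.2}
  code p := pair (F.code p.1.1) p.1.2
  O p := F.O p.1.1
  U p := F.U p.1.1
  isig p := F.isig p.1.1
  bdd p := F.bdd p.1.1

theorem Cmp.congr {f g : F.carrier → M} (hf : F.Cmp f) (h : ∀ x, g x = f x) : F.Cmp g := by
  rwa [show g = f from funext h]

theorem Dec.congr {R S : F.carrier → Prop} (hR : F.Dec R) (h : ∀ x, S x ↔ R x) : F.Dec S := by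
  rwa [show S = R from funext fun x => propext (h x)]

theorem Cmp.const (a : M) : F.Cmp fun _ => a := ⟨_, fun _ => .const a _⟩

theorem Cmp.code : F.Cmp F.code := ⟨_, fun _ => .id _⟩

theorem Cmp.pair {f g : F.carrier → M} (hf : F.Cmp f) (hg : F.Cmp g) :
    F.Cmp fun x => pair (f x) (g x) := by
  obtain ⟨p, hp⟩ := hf
  obtain ⟨q, hq⟩ := hg
  exact ⟨_, fun x => .pairing (hp x) (hq x)⟩

theorem Cmp.apply {f g : F.carrier → M} {p : M} (hf : F.Cmp f)
    (h : ∀ x, PhiUse (F.O x) (F.U x) p (f x) (g x)) : F.Cmp g := by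
  obtain ⟨q, hq⟩ := hf
  exact ⟨_, fun x => .comp (hq x) (h x)⟩

theorem Cmp.add {f g : F.carrier → M} (hf : F.Cmp f) (hg : F.Cmp g) :
    F.Cmp fun x => f x + g x := (hf.pair hg).apply fun _ => .add _ _

theorem Cmp.mul {f g : F.carrier → M} (hf : F.Cmp f) (hg : F.Cmp g) :
    F.Cmp fun x => f x * g x := (hf.pair hg).apply fun _ => .mul _ _

theorem Dec.lt {f g : F.carrier → M} (hf : F.Cmp f) (hg : F.Cmp g) :
    F.Dec fun x => f x < g x := (hf.pair hg).apply fun _ => .lt _ _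

theorem Dec.oracle {f : F.carrier → M} (hf : F.Cmp f) (h : ∀ x, f x ∈ F.U x) :
    F.Dec fun x => f x ∈ F.O x := hf.apply fun x => .oracle (h x)

theorem Dec.not {R : F.carrier → Prop} (hR : F.Dec R) : F.Dec fun x => ¬ R x := by
  refine (Dec.lt hR (.const 1)).congr fun x => ?_
  unfold char
  split_ifs with h <;> simp [h]

theorem Dec.and {R S : F.carrier → Prop} (hR : F.Dec R) (hS : F.Dec S) :
    F.Dec fun x => R x ∧ S x := by
  refine (Cmp.mul hR hS).congr fun x => ?_
  unfold char
  split_ifs <;> simp_all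

theorem Dec.or {R S : F.carrier → Prop} (hR : F.Dec R) (hS : F.Dec S) :
    F.Dec fun x => R x ∨ S x :=
  (hR.not.and hS.not).not.congr fun _ => by tauto

theorem Dec.iff {R S : F.carrier → Prop} (hR : F.Dec R) (hS : F.Dec S) :
    F.Dec fun x => (R x ↔ S x) :=
  ((hR.and hS).or (hR.not.and hS.not)).congr fun _ => by tauto

theorem Dec.eq {f g : F.carrier → M} (hf : F.Cmp f) (hg : F.Cmp g) :
    F.Dec fun x => f x = g x :=
  ((Dec.lt hf hg).not.and (Dec.lt hg hf).not).congr fun _ => by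
    rw [not_lt, not_lt, le_antisymm_iff, and_comm]

variable {Q : F.carrier → M → Prop}

theorem Cmp.fst {f : F.carrier → M} (hf : F.Cmp f) : (F.ext Q).Cmp fun p => f p.1.1 := by
  obtain ⟨q, hq⟩ := hf
  have : (F.ext Q).Cmp fun p => F.code p.1.1 := Cmp.code.apply fun _ => .left _ _
  exact this.apply fun p => hq p.1.1

theorem Cmp.snd : (F.ext Q).Cmp fun p => p.1.2 := Cmp.code.apply fun _ => .right _ _

/-- The search stops at or before `t x`, so `G` has to be computable, with permitted queries, only
up to `t x`. The bound `t` itself need not be computable. -/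
theorem Cmp.search {G : F.carrier → M → M} {t : F.carrier → M}
    (hG : (F.ext fun x a => a ≤ t x).Cmp fun p => G p.1.1 p.1.2)
    (h : ∀ x, ∃ a ≤ t x, G x a = 0) :
    ∃ m, F.Cmp m ∧ ∀ x, m x ≤ t x ∧ G x (m x) = 0 ∧ ∀ z < m x, G x z ≠ 0 := by
  obtain ⟨p, hp⟩ := hG
  have hp' : ∀ x a, a ≤ t x → PhiUse (F.O x) (F.U x) p (RevRec.pair (F.code x) a) (G x a) :=
    fun x a ha => hp ⟨(x, a), ha⟩
  have key : ∀ x, ∃ y, PhiUse (F.O x) (F.U x) (RevRec.pair 4 p) (F.code x) y := by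
    intro x
    obtain ⟨a, ha, h0⟩ := h x
    exact PhiUse.exists_search (F.bdd x) (h0 ▸ hp' x a ha)
      fun z hz => ⟨_, hp' x z (hz.le.trans ha)⟩
  choose m hm using key
  refine ⟨m, ⟨_, hm⟩, fun x => ?_⟩
  obtain ⟨h1, h2⟩ := (hm x).search_inv
  obtain ⟨a, ha, h0⟩ := h x
  have hma : m x ≤ a := by
    by_contra hlt
    obtain ⟨w, hw, h3⟩ := h2 a (not_le.1 hlt)
    exact hw ((h3.unique (hp' x a ha)).trans h0)
  refine ⟨hma.trans ha, ((hp' x _ (hma.trans ha)).unique h1), fun z hz h4 => ?_⟩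
  obtain ⟨w, hw, h3⟩ := h2 z hz
  exact hw ((h3.unique (hp' x z (hz.le.trans (hma.trans ha)))).trans h4)

theorem Dec.ball {R : F.carrier → M → Prop} {t : F.carrier → M} (ht : F.Cmp t)
    (hR : (F.ext fun x a => a ≤ t x).Dec fun p => R p.1.1 p.1.2) :
    F.Dec fun x => ∀ a, a < t x → R x a := by
  -- The search is for the first counterexample, with `t x` as a sentinel that always stops it; this
  -- is why the extended inputs include `a = t x`. The universal statement holds iff the sentinel is
  -- reached.
  obtain ⟨m, hm, h⟩ := Cmp.search (F := F) (t := t)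
    (G := fun x a => char M (a < t x ∧ R x a)) ((Dec.lt Cmp.snd ht.fst).and hR)
    fun x => ⟨t x, le_rfl, by simp [char_eq_zero]⟩
  refine (Dec.lt hm ht).not.congr fun x => ?_
  obtain ⟨h1, h2, h3⟩ := h x
  simp only [char_eq_zero, ne_eq, not_not] at h2 h3
  constructor
  · exact fun hall hlt => h2 ⟨hlt, hall _ hlt⟩
  · exact fun hlt a ha => (h3 a (ha.trans_le (not_lt.1 hlt))).2

theorem Dec.bex {R : F.carrier → M → Prop} {t : F.carrier → M} (ht : F.Cmp t)
    (hR : (F.ext fun x a => a ≤ t x).Dec fun p => R p.1.1 p.1.2) :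
    F.Dec fun x => ∃ a, a < t x ∧ R x a :=
  (Dec.ball (R := fun x a => ¬ R x a) ht hR.not).not.congr fun x => by simp

theorem Cmp.val {v : F.carrier → ℕ → M} (hv : ∀ i, F.Cmp fun x => v x i) (t : ArithTerm) :
    F.Cmp fun x => t.val (v x) := by
  induction t with
  | var i => exact hv i
  | zero => exact .const 0
  | one => exact .const 1
  | add s t hs ht => exact hs.add ht
  | mul s t hs ht => exact hs.mul ht

/-- The formula is a standard object even if `M` is nonstandard, so the program is assembled by
recursion on it; bounded quantifiers become searches. -/
theorem Dec.holds (φ : BddFormula) {F : Frame M} {v : F.carrier → ℕ → M}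
    (hv : ∀ i, F.Cmp fun x => v x i) : F.Dec fun x => φ.Holds ∅ (v x) := by
  induction φ generalizing F with
  | eq s t => exact .eq (.val hv s) (.val hv t)
  | lt s t => exact .lt (.val hv s) (.val hv t)
  | mem t => exact (Cmp.const 0).congr fun x => char_eq_zero.2 (by simp [BddFormula.Holds])
  | not φ h => exact (h hv).not
  | and φ ψ h h' => exact (h hv).and (h' hv)
  | or φ ψ h h' => exact (h hv).or (h' hv)
  | ball i t φ h =>
    refine Dec.ball (R := fun x a => φ.Holds ∅ (Function.update (v x) i a)) (.val hv t) (h ?_)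
    intro j
    by_cases hj : j = i
    · subst hj; simpa using Cmp.snd
    · simpa [Function.update_of_ne hj] using (hv j).fst
  | bex i t φ h =>
    refine Dec.bex (R := fun x a => φ.Holds ∅ (Function.update (v x) i a)) (.val hv t) (h ?_)
    intro j
    by_cases hj : j = i
    · subst hj; simpa using Cmp.snd
    · simpa [Function.update_of_ne hj] using (hv j).fst

/-- The components of `k` are computed by programs. -/
def CmpMap (F : Frame M) {Y : Type u} [Ctx M Y] (k : F.carrier → Y) : Prop :=
  ∀ i, F.Cmp fun x => Ctx.env (k x) i

theorem CmpMap.unit : F.CmpMap fun _ => PUnit.unit.{u + 1} := fun _ => .const 0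

theorem CmpMap.prod {Y : Type u} [Ctx M Y] {k : F.carrier → Y} (hk : F.CmpMap k)
    {f : F.carrier → M} (hf : F.Cmp f) : F.CmpMap fun x => (k x, f x) := by
  intro i
  by_cases h : i = Ctx.size M Y
  · subst h
    simpa [env_prod] using hf
  · simpa [env_prod, Function.update_of_ne h] using hk i

theorem Dec.of_bdd {Y : Type u} [Ctx M Y] {R : Y → Prop} (hR : Bdd (∅ : Set M) R)
    {k : F.carrier → Y} (hk : F.CmpMap k) : F.Dec fun x => R (k x) := by
  obtain ⟨φ, p, h⟩ := hR.out
  refine (Dec.holds φ (v := fun x => mix (Ctx.env (k x)) p) fun i => ?_).congr fun x => h (k x)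
  rcases Nat.even_or_odd' i with ⟨j, rfl | rfl⟩
  · simpa using hk j
  · simpa using Cmp.const (p j)

end Frame

end Programs

/-! ### Powers of two and initial segments -/

section Strings

variable {M : Type u} [CommSemiring M] [LinearOrder M] [PMinus M] {X : Type u} [Ctx M X]

theorem two_mul_ne_two_mul_add_one (a b : M) : 2 * a ≠ 2 * b + 1 := by
  intro h
  rcases le_or_gt a b with hab | hab
  · have : 2 * a ≤ 2 * b := mul_le_mul_of_nonneg_left hab zero_le
    rw [h] at this
    exact absurd (lt_succ_self _) (not_lt.2 this)
  · have h1 : 2 * (b + 1) ≤ 2 * a := mul_le_mul_of_nonneg_left (succ_le_iff.2 hab) zero_le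
    rw [h] at h1
    have h2 : 2 * (b + 1) = 2 * b + 1 + 1 := by ring
    rw [h2] at h1
    exact absurd (lt_succ_self _) (not_lt.2 h1)

theorem IsPowerOfTwo.pos {p : M} (hp : IsPowerOfTwo p) : 0 < p := pos_of_ne_zero' hp.1

theorem isPowerOfTwo_one : IsPowerOfTwo (1 : M) := by
  refine ⟨one_ne_zero, fun q ⟨r, hr⟩ hq => absurd ?_ hq⟩
  have hr0 : 0 < r := pos_of_ne_zero' (by rintro rfl; simp at hr)
  have hq0 : 0 < q := pos_of_ne_zero' (by rintro rfl; simp at hr)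
  exact le_antisymm ((le_mul_of_pos hr0).trans_eq hr.symm) (PMinus.one_le_of_pos q hq0)

theorem IsPowerOfTwo.eq_one_or {p : M} (hp : IsPowerOfTwo p) :
    p = 1 ∨ ∃ q, p = 2 * q ∧ IsPowerOfTwo q := by
  rcases eq_or_ne p 1 with h | h
  · exact Or.inl h
  · obtain ⟨q, rfl⟩ := hp.2 p dvd_rfl h
    refine Or.inr ⟨q, rfl, ?_, fun r hr => hp.2 r (hr.mul_left _)⟩
    rintro rfl
    exact hp.1 (by simp)

theorem isPowerOfTwo_iff_bounded (p : M) :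
    IsPowerOfTwo p ↔ p ≠ 0 ∧ ∀ q ≤ p, q ∣ p → q ≠ 1 → 2 ∣ q := by
  refine and_congr_right fun hp => ⟨fun h q _ => h q, fun h q hq => h q ?_ hq⟩
  obtain ⟨r, rfl⟩ := hq
  exact le_mul_of_pos (pos_of_ne_zero' (by rintro rfl; simp at hp))

instance Bdd.isPowerOfTwo (B : Set M) (f : X → M) [hf : Tm f] :
    Bdd B (fun x => IsPowerOfTwo (f x)) := by
  simp only [isPowerOfTwo_iff_bounded]
  have h : Bdd B (fun p : PUnit.{u + 1} × M => p.2 ≠ 0 ∧ ∀ q ≤ p.2, q ∣ p.2 → q ≠ 1 → 2 ∣ q) := by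
    infer_instance
  exact h.comp (fun x => (PUnit.unit, f x))

variable (B : Set M)

theorem even_or_odd [hB : ISig B] (x : M) : ∃ y, x = 2 * y ∨ x = 2 * y + 1 := by
  refine ISig.induct B (R := fun x => ∃ y, x = 2 * y ∨ x = 2 * y + 1) (by infer_instance)
    ⟨0, by simp⟩ ?_ x
  rintro x ⟨y, rfl | rfl⟩
  · exact ⟨y, Or.inr rfl⟩
  · exact ⟨y + 1, Or.inl (by ring)⟩

theorem IsPowerOfTwo.two_mul [hB : ISig B] {p : M} (hp : IsPowerOfTwo p) :
    IsPowerOfTwo (2 * p) := by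
  refine ⟨mul_ne_zero two_ne_zero hp.1, fun d ⟨k, hk⟩ hd => ?_⟩
  obtain ⟨k', rfl | rfl⟩ := even_or_odd B k
  · refine hp.2 d ⟨k', ?_⟩ hd
    exact mul_left_cancel₀ (two_ne_zero (α := M)) (by rw [hk]; ring)
  · obtain ⟨d', rfl | rfl⟩ := even_or_odd B d
    · exact dvd_mul_right _ _
    · refine absurd ?_ (two_mul_ne_two_mul_add_one p (2 * d' * k' + d' + k'))
      rw [hk]; ring

theorem IsPowerOfTwo.mul [hB : ISig B] {p q : M} (hp : IsPowerOfTwo p) (hq : IsPowerOfTwo q) :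
    IsPowerOfTwo (p * q) := by
  refine ISig.strong_induct B (R := fun p => IsPowerOfTwo p → IsPowerOfTwo (p * q))
    (by infer_instance) (fun p ih hp => ?_) p hp
  rcases hp.eq_one_or with rfl | ⟨r, rfl, hr⟩
  · simpa using hq
  · rw [mul_assoc]
    refine (ih r ?_ hr).two_mul B
    rw [_root_.two_mul]
    exact lt_add_of_pos_left r hr.pos

theorem IsPowerOfTwo.exists_mul_of_le [hB : ISig B] {p q : M} (hp : IsPowerOfTwo p)
    (hq : IsPowerOfTwo q) (h : p ≤ q) : ∃ r, IsPowerOfTwo r ∧ q = p * r := by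
  refine (ISig.strong_induct B (R := fun p => ∀ q' ≤ q, IsPowerOfTwo p → IsPowerOfTwo q' →
    p ≤ q' → ∃ r ≤ q', IsPowerOfTwo r ∧ q' = p * r) (by infer_instance) ?_ p q le_rfl hp hq h).imp fun _ h => h.2
  intro p ih q' hqq hp hq' h
  rcases hp.eq_one_or with rfl | ⟨a, rfl, ha⟩
  · exact ⟨q', le_rfl, hq', (one_mul _).symm⟩
  · rcases hq'.eq_one_or with rfl | ⟨b, rfl, hb⟩
    · have h1 : (1 : M) < 2 := one_lt_two
      have h2 : (2 : M) ≤ 2 * a := le_mul_of_pos ha.pos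
      exact absurd (h2.trans h) (not_le.2 h1)
    · have h1 : ∀ x : M, 0 < x → x < 2 * x := fun x hx => by
        rw [_root_.two_mul]; exact lt_add_of_pos_left x hx
      obtain ⟨r, -, hr, rfl⟩ := ih a (h1 a ha.pos) b ((h1 b hb.pos).le.trans hqq) ha hb
        (le_of_mul_le_mul_left h zero_lt_two)
      exact ⟨r, (le_mul_of_pos hp.pos).trans_eq (by ring), hr, by ring⟩

theorem exists_isPowerOfTwo_gt [hB : ISig B] (x : M) : ∃ p, IsPowerOfTwo p ∧ x < p := by
  refine ISig.induct B (R := fun x => ∃ p, IsPowerOfTwo p ∧ x < p) (by infer_instance)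
    ⟨1, isPowerOfTwo_one, zero_lt_one⟩ ?_ x
  rintro x ⟨p, hp, hx⟩
  refine ⟨2 * p, hp.two_mul B, ?_⟩
  rw [two_mul]
  exact add_lt_add_of_lt_of_le hx (PMinus.one_le_of_pos p hp.pos)

/-! ### Initial segments. -/

theorem isInitialSegment_iff_bounded (τ σ : M) : IsInitialSegment τ σ ↔
    1 ≤ τ ∧ ∃ p ≤ σ, IsPowerOfTwo p ∧ τ * p ≤ σ ∧ σ < (τ + 1) * p := by
  refine and_congr_right fun hτ => ⟨?_, fun ⟨p, _, h⟩ => ⟨p, h⟩⟩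
  rintro ⟨p, hp, h1, h2⟩
  refine ⟨p, ((le_mul_of_pos (zero_lt_one.trans_le hτ)).trans_eq (mul_comm _ _)).trans h1, hp,
    h1, h2⟩

instance Bdd.isInitialSegment (f g : X → M) [hf : Tm f] [hg : Tm g] :
    Bdd B (fun x => IsInitialSegment (f x) (g x)) := by
  have h : Bdd B (fun p : (PUnit.{u + 1} × M) × M => IsInitialSegment p.1.2 p.2) := by
    simp only [isInitialSegment_iff_bounded]; infer_instance
  exact h.comp (fun x => ((PUnit.unit, f x), g x))

theorem IsInitialSegment.refl {σ : M} (h : 1 ≤ σ) : IsInitialSegment σ σ :=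
  ⟨h, 1, isPowerOfTwo_one, by simp, by simp⟩

theorem IsInitialSegment.le {τ σ : M} (h : IsInitialSegment τ σ) : τ ≤ σ := by
  obtain ⟨-, p, hp, h1, -⟩ := h
  exact (le_mul_of_pos hp.pos).trans h1

theorem IsInitialSegment.trans [hB : ISig B] {ρ τ σ : M} (h : IsInitialSegment ρ τ)
    (h' : IsInitialSegment τ σ) : IsInitialSegment ρ σ := by
  obtain ⟨hρ, q, hq, h1, h2⟩ := h
  obtain ⟨-, p, hp, h3, h4⟩ := h'
  refine ⟨hρ, q * p, hq.mul B hp, ?_, h4.trans_le ?_⟩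
  · rw [← mul_assoc]
    exact (mul_le_mul_of_nonneg_right h1 zero_le).trans h3
  · rw [← mul_assoc]
    exact mul_le_mul_of_nonneg_right (succ_le_iff.2 h2) zero_le

/-- Of the two powers of two that truncate `σ`, the smaller divides the larger. If `y` is the longer
truncation, the quotient truncates `y` to `x`; otherwise `x ≤ y` forces equality. -/
theorem IsInitialSegment.of_le [hB : ISig B] {x y σ : M} (hx : IsInitialSegment x σ)
    (hy : IsInitialSegment y σ) (hxy : x ≤ y) : IsInitialSegment x y := by
  obtain ⟨hx1, q, hq, h1, h2⟩ := hx
  obtain ⟨hy1, p, hp, h3, h4⟩ := hy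
  rcases le_total p q with hpq | hpq
  · obtain ⟨r, hr, rfl⟩ := hp.exists_mul_of_le B hq hpq
    refine ⟨hx1, r, hr, lt_succ_iff.1 ?_, ?_⟩
    · refine lt_of_mul_lt_mul_right (a := p) ?_ zero_le
      refine lt_of_le_of_lt (le_of_eq_of_le ?_ h1) h4
      ring
    · refine lt_of_mul_lt_mul_right (a := p) ?_ zero_le
      refine (h3.trans_lt h2).trans_eq ?_
      ring
  · obtain ⟨r, hr, rfl⟩ := hq.exists_mul_of_le B hp hpq
    have h5 : y * r < x + 1 := by
      refine lt_of_mul_lt_mul_right (a := q) ?_ zero_le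
      refine lt_of_le_of_lt (le_of_eq_of_le ?_ h3) h2
      ring
    have h6 : x = y := le_antisymm hxy ((le_mul_of_pos hr.pos).trans (lt_succ_iff.1 h5))
    subst h6
    exact .refl hx1

/-- Deleting final digits until the value drops below `2b` does not lead below `b`. The interval
`[b, 2b)` thus plays the role of a level of the tree, for any `b ≥ 1`, and lengths of strings are
not needed. -/
theorem exists_isInitialSegment [hB : ISig B] {b σ : M} (hb : 1 ≤ b) (h : b ≤ σ) :
    ∃ τ, IsInitialSegment τ σ ∧ b ≤ τ ∧ τ < 2 * b := by
  have hb0 : 0 < b := zero_lt_one.trans_le hb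
  obtain ⟨p, ⟨hp, hlt⟩, hmin⟩ := ISig.exists_least B
    (R := fun p => IsPowerOfTwo p ∧ σ < 2 * b * p) (by infer_instance) (by
      obtain ⟨p, hp, hσ⟩ := exists_isPowerOfTwo_gt B σ
      exact ⟨p, hp, hσ.trans_le ((le_mul_of_pos (mul_pos zero_lt_two hb0)).trans_eq
        (mul_comm _ _))⟩)
  rcases hp.eq_one_or with rfl | ⟨q, rfl, hq⟩
  · exact ⟨σ, .refl (hb.trans h), h, by simpa using hlt⟩
  · have h1 : b * (2 * q) ≤ σ := by
      by_contra hc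
      refine hmin q ?_ ⟨hq, lt_of_lt_of_eq (not_le.1 hc) (by ring)⟩
      rw [two_mul]
      exact lt_add_of_pos_left q hq.pos
    obtain ⟨τ, hτ, hτ'⟩ := ISig.exists_greatest B (R := fun τ => τ * (2 * q) ≤ σ)
      (by infer_instance) (by simp) (n := 2 * b) (not_le.2 hlt)
    have h2 : b < τ + 1 :=
      lt_of_mul_lt_mul_right (a := 2 * q) (h1.trans_lt (not_le.1 hτ')) zero_le
    have h3 : τ < 2 * b :=
      lt_of_mul_lt_mul_right (a := 2 * q) (hτ.trans_lt hlt) zero_le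
    exact ⟨τ, ⟨hb.trans (lt_succ_iff.1 h2), 2 * q, hp, hτ, not_le.1 hτ'⟩, lt_succ_iff.1 h2, h3⟩

end Strings

/-! ### Forcing the jump -/

section Forcing

variable {M : Type u} [CommSemiring M] [LinearOrder M] [PMinus M] {X : Type u} [Ctx M X]

/-- The set of initial segments of a string. -/
def init (τ : M) : Set M := {σ | IsInitialSegment σ τ}

/-- The program `e` halts at the input `e` with oracle `init τ` by a computation below `τ`. -/
def Halts (τ e : M) : Prop :=
  ∃ d < τ, ∃ y < d, MemCode (pair e (pair e y)) d ∧ Closed (init τ) Set.univ d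

theorem halts_iff {τ e : M} : Halts τ e ↔ ∃ d < τ, ∃ y, IsComputation (init τ) e e y d :=
  ⟨fun ⟨d, hd, y, _, h, h'⟩ => ⟨d, hd, y, h'.isComputation h⟩,
    fun ⟨d, hd, y, h⟩ => ⟨d, hd, y, (entry_lt h.1).2.2, h.1, h.closed⟩⟩

instance Bdd.halts (B : Set M) (f g : X → M) [hf : Tm f] [hg : Tm g] :
    Bdd B (fun x => Halts (f x) (g x)) := by
  have h : Bdd B (fun p : (PUnit.{u + 1} × M) × M => Halts p.1.2 p.2) := by
    have := (Bdd.closed (C := B) (O := fun x : PUnit.{u + 1} × M => init x.2)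
      (V := fun _ => Set.univ) (by simp only [init, Set.mem_ofPred_eq]; infer_instance)
      (by simp only [Set.mem_univ]; infer_instance)).comp
        (fun p : ((((PUnit.{u + 1} × M) × M) × M) × M) => (p.1.1.1, p.1.2))
    unfold Halts
    infer_instance
  exact h.comp (fun x => ((PUnit.unit, f x), g x))

/-- No program `j < i` outside the set coded by `c` halts on `τ`. -/
def Avoids (c i τ : M) : Prop := ∀ j < i, ¬ MemCode j c → ¬ Halts τ j

instance Bdd.avoids (B : Set M) (f g h : X → M) [hf : Tm f] [hg : Tm g] [hh : Tm h] :
    Bdd B (fun x => Avoids (f x) (g x) (h x)) := by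
  have h' : Bdd B (fun p : ((PUnit.{u + 1} × M) × M) × M => Avoids p.1.1.2 p.1.2 p.2) := by
    unfold Avoids; infer_instance
  exact h'.comp (fun x => (((PUnit.unit, f x), g x), h x))

/-- The subtree of those strings that avoid the programs below `i` outside the set coded by `c`
and on which `i` does not halt has no elements in some interval `[b, 2b)`. -/
def Forced (T : Set M) (c i : M) : Prop :=
  ∃ b, 1 ≤ b ∧ ∀ τ < 2 * b, ¬ ((b ≤ τ ∧ Avoids c i τ ∧ ¬ Halts τ i) ∧ τ ∈ T)

instance Sg.forced (T : Set M) [hT : ISig T] (f g : X → M) [hf : Tm f] [hg : Tm g] :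
    Sg T (fun x => Forced T (f x) (g x)) := by
  have h : Sg T (fun p : (PUnit.{u + 1} × M) × M => Forced T p.1.2 p.2) := by
    unfold Forced; infer_instance
  exact h.comp (fun x => ((PUnit.unit, f x), g x))

/-- The code `c` decides correctly which programs below `n` are forced to halt. -/
def Correct (T : Set M) (n c : M) : Prop := ∀ i < n, (MemCode i c ↔ Forced T c i)

/-- The set of all programs that are forced to halt. -/
def forcedSet (T : Set M) : Set M := {e | ∃ c, Correct T (e + 1) c ∧ MemCode e c}

theorem Avoids.congr {c c' i τ : M} (h : ∀ j < i, MemCode j c ↔ MemCode j c')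
    (hA : Avoids c i τ) : Avoids c' i τ := fun j hj hjc => hA j hj (mt (h j hj).1 hjc)

theorem Forced.congr {T : Set M} {c c' i : M} (h : ∀ j < i, MemCode j c ↔ MemCode j c')
    (hF : Forced T c i) : Forced T c' i := by
  obtain ⟨b, hb, hF⟩ := hF
  exact ⟨b, hb, fun τ hτ ⟨⟨h1, h2, h3⟩, h4⟩ =>
    hF τ hτ ⟨⟨h1, h2.congr fun j hj => (h j hj).symm, h3⟩, h4⟩⟩

theorem forced_congr {T : Set M} {c c' i : M} (h : ∀ j < i, MemCode j c ↔ MemCode j c') :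
    Forced T c i ↔ Forced T c' i :=
  ⟨Forced.congr h, Forced.congr fun j hj => (h j hj).symm⟩

variable {T : Set M}

theorem Correct.mono {n m c : M} (h : Correct T n c) (hm : m ≤ n) : Correct T m c :=
  fun i hi => h i (hi.trans_le hm)

/-! ### Existence and uniqueness of correct codes. -/

variable [hTI : ISig T]

/-- Being correct is not a `Σ₁` condition, so induction on it is not directly available. Bounded
comprehension first records in `z` the answers to `Forced` for all pairs with `c < w` and `i < n`;
relative to `z` the recursion along `i` is bounded, and all its intermediate sets have codes below
`w`. -/
theorem exists_correct {n w : M} (hw : SubsetBound n w) : ∃ c < w, Correct T n c := by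
  obtain ⟨z, hz⟩ := exists_code' T (pair w n) (R := fun q => ∃ c i, q = pair c i ∧ Forced T c i)
    (by infer_instance)
  have hz' : ∀ c < w, ∀ i < n, MemCode (pair c i) z ↔ Forced T c i := by
    intro c hc i hi
    rw [hz]
    constructor
    · rintro ⟨-, c', i', h, h'⟩
      obtain ⟨rfl, rfl⟩ := pair_inj h
      exact h'
    · exact fun h => ⟨(pair_le_pair hc.le le_rfl).trans_lt (pair_lt_pair_right hi), c, i, rfl, h⟩
  obtain ⟨c, hc, h⟩ := ISig.induct_le T
    (R := fun k => ∃ c < w, ∀ i < k, (MemCode i c ↔ MemCode (pair c i) z)) (by infer_instance) n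
    (by
      obtain ⟨c, hc, -⟩ := exists_code T hw (R := fun _ => False) (by infer_instance)
      exact ⟨c, hc, fun i hi => absurd hi (not_lt.2 zero_le)⟩)
    (by
      rintro k hk ⟨c, hc, h⟩
      obtain ⟨c', hc', h'⟩ := exists_code T hw
        (R := fun j => (j < k ∧ MemCode j c) ∨ (j = k ∧ MemCode (pair c k) z)) (by infer_instance)
      have agree : ∀ j < k, MemCode j c ↔ MemCode j c' := by
        intro j hj
        rw [h']
        simp [hj, hj.ne, hj.trans hk]
      refine ⟨c', hc', fun i hi => ?_⟩
      rcases lt_succ_cases hi with hi | rfl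
      · rw [← agree i hi, h i hi, hz' c hc i (hi.trans hk), hz' c' hc' i (hi.trans hk)]
        exact forced_congr fun j hj => agree j (hj.trans hi)
      · rw [hz' c' hc' i hk, ← forced_congr agree, ← hz' c hc i hk, h']
        simp [hk])
  exact ⟨c, hc, fun i hi => (h i hi).trans (hz' c hc i hi)⟩

theorem exists_correct' (n : M) : ∃ c, Correct T n c := by
  obtain ⟨w, hw⟩ := exists_subsetBound T n
  obtain ⟨c, -, hc⟩ := exists_correct (T := T) hw
  exact ⟨c, hc⟩

theorem Correct.unique {n c c' : M} (h : Correct T n c) (h' : Correct T n c') {i : M}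
    (hi : i < n) : MemCode i c ↔ MemCode i c' := by
  have key := ISig.induct_le T (R := fun k => ∀ j < k, (MemCode j c ↔ MemCode j c'))
    (by infer_instance) n (fun j hj => absurd hj (not_lt.2 zero_le)) (fun k hk ih j hj => by
      rcases lt_succ_cases hj with hj | rfl
      · exact ih j hj
      · rw [h j hk, h' j hk]
        exact forced_congr ih)
  exact key i hi

theorem Correct.mem_forcedSet {n c e : M} (h : Correct T n c) (he : e < n) :
    e ∈ forcedSet T ↔ MemCode e c := by
  have h1 := h.mono (succ_le_iff.2 he)
  constructor
  · rintro ⟨c', hc', hec⟩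
    exact (h1.unique hc' (lt_succ_self e)).2 hec
  · exact fun hec => ⟨c, h1, hec⟩

/-- A computation below `τ` queries only numbers below `τ`, where `init τ` and `init σ` agree. -/
theorem Halts.mono (B : Set M) [hB : ISig B] {τ σ e : M} (hτ : IsInitialSegment τ σ) (h : Halts τ e) : Halts σ e := by
  obtain ⟨d, hd, y, h⟩ := halts_iff.1 h
  refine halts_iff.2 ⟨d, hd.trans_le hτ.le, y, h.congr_oracle fun q hq => ?_⟩
  exact ⟨fun h => IsInitialSegment.trans B h hτ,
    fun h => IsInitialSegment.of_le B h hτ (hq.trans hd).le⟩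

theorem Avoids.mono (B : Set M) [hB : ISig B] {c i τ σ : M} (hτ : IsInitialSegment τ σ) (h : Avoids c i σ) :
    Avoids c i τ := fun j hj hjc hh => h j hj hjc (hh.mono B hτ)

/-- Arbitrarily long strings of the tree avoid the programs that are not forced to halt. -/
theorem Correct.exists_avoids (hT : IsBinaryTree T) (hinf : IsInfinite T) {n c : M}
    (h : Correct T n c) (b : M) : ∃ τ ∈ T, b ≤ τ ∧ Avoids c n τ := by
  -- `R k` says that the strings of `T` avoiding the programs below `k` miss some interval `[b,
  -- 2b)`. This is `Σ₁`, so its failure can be carried from `0` to `n`.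
  have key := ISig.pi_induct_le T
    (R := fun k => ∃ b, 1 ≤ b ∧ ∀ τ < 2 * b, ¬ ((b ≤ τ ∧ Avoids c k τ) ∧ τ ∈ T))
    (by infer_instance) n ?_ ?_
  · push Not at key
    obtain ⟨τ, -, ⟨h1, h2⟩, h3⟩ := key (max b 1) (le_max_right _ _)
    exact ⟨τ, h3, (le_max_left _ _).trans h1, h2⟩
  · rintro ⟨b, hb, h0⟩
    refine hinf ⟨b, fun a ha => ?_⟩
    by_contra hba
    obtain ⟨τ, hτ, h1, h2⟩ := exists_isInitialSegment T hb (not_lt.1 hba)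
    exact h0 τ h2 ⟨⟨h1, fun j hj => absurd hj (not_lt.2 zero_le)⟩, hT.2 a ha τ hτ⟩
  · rintro k hk hk' ⟨b, hb, h0⟩
    by_cases hkc : MemCode k c
    · refine hk' ⟨b, hb, fun τ hτ ⟨⟨h1, h2⟩, h3⟩ => h0 τ hτ ⟨⟨h1, fun j hj hjc => ?_⟩, h3⟩⟩
      rcases lt_succ_cases hj with hj | rfl
      · exact h2 j hj hjc
      · exact absurd hkc hjc
    -- For `k` outside `c`, avoiding also `k` cuts down to exactly the subtree considered in
    -- `Forced`; a bound for it would put `k` into `c`.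
    · refine hkc ((h k hk).2 ⟨b, hb, fun τ hτ ⟨⟨h1, h2, h3⟩, h4⟩ =>
        h0 τ hτ ⟨⟨h1, fun j hj hjc => ?_⟩, h4⟩⟩)
      rcases lt_succ_cases hj with hj | rfl
      · exact h2 j hj hjc
      · exact h3

/-- A program that is forced to halt halts on all long strings. -/
theorem Forced.halts (hT : IsBinaryTree T) {c i : M} (h : Forced T c i) :
    ∃ b, 1 ≤ b ∧ ∀ τ ∈ T, b ≤ τ → Avoids c i τ → Halts τ i := by
  obtain ⟨b, hb, h⟩ := h
  refine ⟨b, hb, fun τ hτ hbτ hA => ?_⟩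
  by_contra hn
  obtain ⟨ρ, hρ, h1, h2⟩ := exists_isInitialSegment T hb hbτ
  exact h ρ h2 ⟨⟨h1, hA.mono T hρ, fun hh => hn (hh.mono T hρ)⟩, hT.2 τ hτ ρ hρ⟩

end Forcing

/-! ### The path -/

section Path

variable {M : Type u} [CommSemiring M] [LinearOrder M] [PMinus M]

/-- A program that halts exactly if `σ` is not in the oracle. -/
def escape (σ : M) : M := pair 4 (pair 3 (pair (pair 1 6) (pair 0 σ)))

theorem escape_le {σ τ : M} (h : σ ≤ τ) : escape σ ≤ escape τ :=
  pair_le_pair le_rfl (pair_le_pair le_rfl (pair_le_pair le_rfl (pair_le_pair le_rfl h)))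

theorem not_mem_of_escape {B : Set M} {σ z y : M} (h : Phi B (escape σ) z y) : σ ∉ B := by
  obtain ⟨h1, -⟩ := (phi_iff.1 h).search_inv
  obtain ⟨u, hu, d, h2, hd⟩ := h1.comp_inv
  obtain rfl := hu.const_inv
  exact ((hd _ _ _ h2).1.oracle_inv.resolve_left fun h => zero_ne_one h.2).1

/-- The program queries only `σ`, so its computation with the empty oracle serves every oracle that
omits `σ`. -/
theorem exists_escape_computation (C : Set M) [hC : ISig C] (σ z : M) :
    ∃ d y, ∀ B : Set M, σ ∉ B → IsComputation B (escape σ) z y d := by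
  have := ISig.empty C
  have h1 : PhiUse (∅ : Set M) {σ} (pair 3 (pair (pair 1 6) (pair 0 σ))) (pair z 0) 0 := by
    have h := PhiUse.oracle (B := (∅ : Set M)) (U := {σ}) (x := σ) rfl
    rw [char_eq_zero.2 (by simp)] at h
    exact .comp (.const σ _) h
  obtain ⟨y, d, h, hd⟩ := h1.exists_search (by simp only [Set.mem_singleton_iff]; infer_instance)
    fun z hz => absurd hz (not_lt.2 zero_le)
  refine ⟨d, y, fun B hB => (hd.congr_oracle fun q hq => ?_).isComputation h⟩
  rw [Set.mem_singleton_iff.1 hq]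
  simpa using hB

/-- The strings that cannot be forced out of the oracle. -/
def forcedPath (T : Set M) : Set M := {σ | 1 ≤ σ ∧ escape σ ∉ forcedSet T}

variable {T : Set M} [hTI : ISig T]

/-- Two indices are compared on a common long string. -/
theorem exists_long (hT : IsBinaryTree T) (hinf : IsInfinite T) (n b : M) :
    ∃ c τ, Correct T n c ∧ τ ∈ T ∧ b ≤ τ ∧ Avoids c n τ := by
  obtain ⟨c, hc⟩ := exists_correct' (T := T) n
  obtain ⟨τ, h1, h2, h3⟩ := hc.exists_avoids hT hinf b
  exact ⟨c, τ, hc, h1, h2, h3⟩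

theorem Avoids.not_halts {n c e τ : M} (hc : Correct T n c) (he : e < n) (h : e ∉ forcedSet T)
    (hA : Avoids c n τ) : ¬ Halts τ e :=
  hA e he (mt (hc.mem_forcedSet he).2 h)

/-- Correct codes agree on their common range, so the bound found for one of them applies to strings
that avoid programs in the sense of any other. -/
theorem exists_forall_halts (hT : IsBinaryTree T) {e : M} (h : e ∈ forcedSet T) :
    ∃ b, 1 ≤ b ∧ ∀ n c τ, Correct T n c → e < n → τ ∈ T → b ≤ τ → Avoids c n τ → Halts τ e := by
  obtain ⟨c₀, hc₀, hec₀⟩ := h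
  obtain ⟨b, hb, h⟩ := ((hc₀ e (lt_succ_self e)).1 hec₀).halts hT
  refine ⟨b, hb, fun n c τ hc he hτ hbτ hA => h τ hτ hbτ fun j hj hjc => ?_⟩
  exact hA j (hj.trans he) (mt ((hc.mono (succ_le_iff.2 he)).unique hc₀
    (hj.trans (lt_succ_self e))).1 hjc)

/-- Every element of the path is an initial segment of all long strings that avoid enough
programs. -/
theorem exists_forall_isInitialSegment {σ : M} (h : σ ∈ forcedPath T) :
    ∃ b, ∀ n c τ, Correct T n c → escape σ < n → b ≤ τ → Avoids c n τ → IsInitialSegment σ τ := by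
  obtain ⟨d, y, hd⟩ := exists_escape_computation T σ (escape σ)
  -- The string has to exceed the code `d` of the escape computation: if `σ` were not an initial
  -- segment of `τ`, this computation would then count as halting on `τ`.
  refine ⟨d + 1, fun n c τ hc hn hb hA => ?_⟩
  by_contra hσ
  exact hA.not_halts hc hn h.2 (halts_iff.2 ⟨d, succ_le_iff.1 hb, y, hd _ hσ⟩)

theorem Halts.not_isInitialSegment {σ τ : M} (h : Halts τ (escape σ)) :
    ¬ IsInitialSegment σ τ := by
  obtain ⟨d, -, y, h⟩ := halts_iff.1 h
  exact not_mem_of_escape (B := init τ) ⟨d, h⟩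

/-- An element of the path lies below strings of `T` that are as long, and avoid as many unforced
programs, as desired. Properties of the path are transferred along such strings. -/
theorem exists_isInitialSegment_of_mem (hT : IsBinaryTree T) (hinf : IsInfinite T) {σ : M}
    (h : σ ∈ forcedPath T) (n b : M) :
    ∃ m c τ, n ≤ m ∧ Correct T m c ∧ τ ∈ T ∧ b ≤ τ ∧ Avoids c m τ ∧ IsInitialSegment σ τ := by
  obtain ⟨b', hb'⟩ := exists_forall_isInitialSegment h
  obtain ⟨c, τ, hc, hτ, hbτ, hA⟩ := exists_long hT hinf (max n (escape σ + 1)) (max b b')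
  exact ⟨_, c, τ, le_max_left _ _, hc, hτ, (le_max_left _ _).trans hbτ, hA,
    hb' _ c τ hc (succ_le_iff.1 (le_max_right _ _)) ((le_max_right _ _).trans hbτ) hA⟩

theorem forcedPath_subset (hT : IsBinaryTree T) (hinf : IsInfinite T) : forcedPath T ⊆ T := by
  intro σ hσ
  obtain ⟨m, c, τ, -, -, hτ, -, -, h⟩ := exists_isInitialSegment_of_mem hT hinf hσ 0 0
  exact hT.2 τ hτ σ h

theorem mem_forcedPath_of_isInitialSegment (hT : IsBinaryTree T) (hinf : IsInfinite T) {σ ρ : M}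
    (hσ : σ ∈ forcedPath T) (h : IsInitialSegment ρ σ) : ρ ∈ forcedPath T := by
  refine ⟨h.1, fun hf => ?_⟩
  obtain ⟨b, -, hb⟩ := exists_forall_halts hT hf
  obtain ⟨m, c, τ, hm, hc, hτ, hbτ, hA, hστ⟩ :=
    exists_isInitialSegment_of_mem hT hinf hσ (escape ρ + 1) b
  exact (hb m c τ hc (succ_le_iff.1 hm) hτ hbτ hA).not_isInitialSegment (h.trans T hστ)

theorem isPath_forcedPath (hT : IsBinaryTree T) (hinf : IsInfinite T) :
    IsPath (forcedPath T) := by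
  refine ⟨⟨fun σ hσ => hσ.1, fun σ hσ τ hτ =>
    mem_forcedPath_of_isInitialSegment hT hinf hσ hτ⟩, fun σ hσ ρ hρ => ?_⟩
  obtain ⟨b, hb⟩ := exists_forall_isInitialSegment hρ
  obtain ⟨m, c, τ, hm, hc, hτ, hbτ, hA, hστ⟩ :=
    exists_isInitialSegment_of_mem hT hinf hσ (escape ρ + 1) b
  have hρτ := hb m c τ hc (succ_le_iff.1 hm) hbτ hA
  rcases le_total σ ρ with h | h
  · exact Or.inl (hστ.of_le T hρτ h)
  · exact Or.inr (hρτ.of_le T hστ h)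

/-- If the path missed `[b, 2b)`, all escape programs of strings in this interval would be forced,
with one common bound by collection. A longer string `τ` avoiding the unforced programs has an
initial segment `σ` in the interval, yet `escape σ` would have to halt on some initial segment of
`τ`, hence on `τ`, against `σ` being one of its initial segments. -/
theorem exists_mem_forcedPath (hT : IsBinaryTree T) (hinf : IsInfinite T) {b : M} (hb : 1 ≤ b) :
    ∃ σ ∈ forcedPath T, b ≤ σ := by
  by_contra hn
  push Not at hn
  obtain ⟨c, hc⟩ := exists_correct' (T := T) (escape (2 * b))
  have hforced : ∀ σ < 2 * b, b ≤ σ → Forced T c (escape σ) := by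
    intro σ hσ hbσ
    have hlt : escape σ < escape (2 * b) := by
      refine lt_of_le_of_ne (escape_le hσ.le) fun h => hσ.ne ?_
      simpa [escape] using h
    refine (hc _ hlt).1 ((hc.mem_forcedSet hlt).1 ?_)
    by_contra hf
    exact absurd (hn σ ⟨hb.trans hbσ, hf⟩) (not_lt.2 hbσ)
  obtain ⟨s, hs⟩ := ISig.collection T (R := fun σ a => b ≤ σ → 1 ≤ a ∧ ∀ τ < 2 * a,
    ¬ ((a ≤ τ ∧ Avoids c (escape σ) τ ∧ ¬ Halts τ (escape σ)) ∧ τ ∈ T))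
    (by unfold escape; infer_instance) (2 * b) (by
      intro σ hσ
      by_cases hbσ : b ≤ σ
      · obtain ⟨a, h⟩ := hforced σ hσ hbσ
        exact ⟨a, fun _ => h⟩
      -- Collection runs over all `σ < 2b`; below `b` nothing is claimed and `0` is a dummy value.
      · exact ⟨0, fun h => absurd h hbσ⟩)
  obtain ⟨τ, hτ, hsτ, hA⟩ := hc.exists_avoids hT hinf (max s b)
  obtain ⟨σ, hσ, hbσ, hσb⟩ := exists_isInitialSegment T hb ((le_max_right _ _).trans hsτ)
  obtain ⟨a, has, ha⟩ := hs σ hσb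
  obtain ⟨ha1, ha⟩ := ha hbσ
  have hle := escape_le hσb.le
  obtain ⟨ρ, hρ, h1, h2⟩ := exists_isInitialSegment T ha1
    (has.trans ((le_max_left _ _).trans hsτ))
  refine ha ρ h2 ⟨⟨h1, fun j hj hjc => ?_, fun hh => ?_⟩, hT.2 τ hτ ρ hρ⟩
  · exact fun hh => hA j (hj.trans_le hle) hjc (hh.mono T hρ)
  · exact (hh.mono T hρ).not_isInitialSegment hσ

theorem isInfinite_forcedPath (hT : IsBinaryTree T) (hinf : IsInfinite T) :
    IsInfinite (forcedPath T) := by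
  rintro ⟨b, hb⟩
  obtain ⟨σ, hσ, hbσ⟩ := exists_mem_forcedPath hT hinf (le_max_right b 1)
  exact absurd (hb σ hσ) (not_lt.2 ((le_max_left _ _).trans hbσ))

/-- Below an element `σ` of the path, the path agrees with the set of initial segments of `σ`. -/
theorem mem_forcedPath_iff (hT : IsBinaryTree T) (hinf : IsInfinite T) {σ q : M}
    (hσ : σ ∈ forcedPath T) (hq : q ≤ σ) : q ∈ forcedPath T ↔ q ∈ init σ := by
  refine ⟨fun h => ?_, mem_forcedPath_of_isInitialSegment hT hinf hσ⟩
  rcases (isPath_forcedPath hT hinf).2 q h σ hσ with h' | h'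
  · exact h'
  · rw [le_antisymm hq h'.le]
    exact .refl hσ.1

/-- A computation with the path as oracle is a computation with `init σ` for any longer `σ` on the
path. Such a `σ` extends to a string of `T` avoiding the unforced programs, which excludes halting
of an unforced one; a forced one halts on `σ` as soon as `σ` is long enough. -/
theorem jump_forcedPath (hT : IsBinaryTree T) (hinf : IsInfinite T) :
    jump (forcedPath T) = forcedSet T := by
  ext e
  constructor
  · rintro ⟨y, d, hd⟩
    by_contra he
    obtain ⟨σ, hσ, hdσ⟩ := exists_mem_forcedPath hT hinf (le_max_right (d + 1) 1)
    have hdσ' : d < σ := succ_le_iff.1 ((le_max_left _ _).trans hdσ)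
    obtain ⟨m, c, τ, hm, hc, hτ, -, hA, hστ⟩ :=
      exists_isInitialSegment_of_mem hT hinf hσ (e + 1) 0
    have hh : Halts σ e := halts_iff.2 ⟨d, hdσ', y, hd.congr_oracle fun q hq =>
      mem_forcedPath_iff hT hinf hσ (hq.trans hdσ').le⟩
    exact hA.not_halts hc (succ_le_iff.1 hm) he (hh.mono T hστ)
  · intro he
    obtain ⟨b, hb1, hb⟩ := exists_forall_halts hT he
    obtain ⟨σ, hσ, hbσ⟩ := exists_mem_forcedPath hT hinf hb1
    obtain ⟨m, c, τ, hm, hc, hτ, -, hA, hστ⟩ :=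
      exists_isInitialSegment_of_mem hT hinf hσ (e + 1) 0
    obtain ⟨d, hd, y, h⟩ := halts_iff.1 (hb m c σ hc (succ_le_iff.1 hm)
      (hT.2 τ hτ σ hστ) hbσ (hA.mono T hστ))
    exact ⟨y, d, h.congr_oracle fun q hq =>
      (mem_forcedPath_iff hT hinf hσ (hq.trans hd).le).symm⟩

end Path

/-! ### The reduction -/

section Reduction

variable {M : Type u} [CommSemiring M] [LinearOrder M] [PMinus M]

/-! ### Queries to the jump that decide `Forced`. -/

theorem exists_forced_program (T : Set M) [hT : ISig T] :
    ∃ p, ∀ c i, (∃ y, Phi T p (pair c i) y) ↔ Forced T c i := by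
  let F : Frame M :=
    { carrier := M × M
      code := fun x => pair x.1 x.2
      O := fun _ => T
      U := fun _ => Set.univ
      isig := fun _ => hT
      bdd := fun _ => by simp only [Set.mem_univ]; infer_instance }
  have hc : F.Cmp fun x => x.1 := Frame.Cmp.code.apply fun x => .left _ _
  have hi : F.Cmp fun x => x.2 := Frame.Cmp.code.apply fun x => .right _ _
  let F₁ := F.ext fun _ _ => True
  have hb : F₁.Cmp fun x => x.1.2 := Frame.Cmp.snd
  have hR : Bdd (∅ : Set M) (fun p : (((PUnit.{u + 1} × M) × M) × M) × M =>
      p.1.2 ≤ p.2 ∧ Avoids p.1.1.1.2 p.1.1.2 p.2 ∧ ¬ Halts p.2 p.1.1.2) := by infer_instance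
  have hball : F₁.Dec fun x => ∀ τ, τ < 2 * x.1.2 →
      ¬ ((x.1.2 ≤ τ ∧ Avoids x.1.1.1 x.1.1.2 τ ∧ ¬ Halts τ x.1.1.2) ∧ τ ∈ T) := by
    refine Frame.Dec.ball (F := F₁) (t := fun x => 2 * x.1.2) (R := fun x τ =>
      ¬ ((x.1.2 ≤ τ ∧ Avoids x.1.1.1 x.1.1.2 τ ∧ ¬ Halts τ x.1.1.2) ∧ τ ∈ T))
      ((Frame.Cmp.const 2).mul hb) ?_
    have h1 := Frame.Dec.of_bdd hR ((((Frame.CmpMap.unit (F := F₁.ext fun x a => a ≤ 2 * x.1.2)).prod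
      hc.fst.fst).prod hi.fst.fst).prod hb.fst |>.prod Frame.Cmp.snd)
    exact (h1.and (Frame.Dec.oracle Frame.Cmp.snd fun x => Set.mem_univ _)).not
  -- Unbounded search stops at the value `0`, so the negated condition is the one to be decided.
  obtain ⟨p, hp⟩ := ((Frame.Dec.lt hb (.const 1)).not.and hball).not
  have hp' : ∀ c i b, PhiUse T Set.univ p (pair (pair c i) b) (char M (¬ (¬ b < 1 ∧ ∀ τ,
      τ < 2 * b → ¬ ((b ≤ τ ∧ Avoids c i τ ∧ ¬ Halts τ i) ∧ τ ∈ T)))) := fun c i b => hp ⟨((c, i), b), trivial⟩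
  refine ⟨pair 4 p, fun c i => ⟨?_, ?_⟩⟩
  · rintro ⟨y, h⟩
    have h0 := (hp' c i y).unique (phi_iff.1 h).search_inv.1
    rw [char_eq_zero, not_not, not_lt] at h0
    exact ⟨y, h0⟩
  · rintro ⟨b, hb1, h⟩
    have h0 := hp' c i b
    rw [char_eq_zero.2 (by rw [not_not, not_lt]; exact ⟨hb1, h⟩)] at h0
    obtain ⟨y, hy⟩ := h0.exists_search (by simp only [Set.mem_univ]; infer_instance)
      fun z _ => ⟨_, hp' c i z⟩
    exact ⟨y, hy.phi⟩

/-- A program that applies `p` to `⟨c, i⟩`, whatever its input. -/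
def specialize (p c i : M) : M := pair 3 (pair p (pair 0 (pair c i)))

instance Tm.specialize (p : M) {X : Type u} [Ctx M X] (f g : X → M) [hf : Tm f] [hg : Tm g] :
    Tm (fun x => specialize p (f x) (g x)) := by
  unfold RevRec.specialize; infer_instance

theorem specialize_le {p c i c' i' : M} (hc : c ≤ c') (hi : i ≤ i') :
    specialize p c i ≤ specialize p c' i' :=
  pair_le_pair le_rfl (pair_le_pair le_rfl (pair_le_pair le_rfl (pair_le_pair hc hi)))

theorem specialize_mem_jump {T : Set M} [hT : ISig T] {p c i : M} :
    specialize p c i ∈ jump T ↔ ∃ y, Phi T p (pair c i) y := by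
  constructor
  · rintro ⟨y, h⟩
    obtain ⟨u, hu, h⟩ := (phi_iff.1 h).comp_inv
    obtain rfl := hu.const_inv
    exact ⟨y, h.phi⟩
  · rintro ⟨y, h⟩
    exact ⟨y, (PhiUse.comp (.const _ _) (phi_iff.1 h)).phi⟩

/-! ### The decision procedure with finite oracles. -/

/-- `c < m` codes a set containing `x` that the oracle `B` takes for correct. -/
def Accepts (p : M) (B : Set M) (m x : M) : Prop :=
  ∃ c, c < m ∧ MemCode x c ∧ ∀ i, i < x + 1 → (MemCode i c ↔ specialize p c i ∈ B)

theorem Accepts.congr {p m x w : M} {B B' : Set M} (hmw : m ≤ w)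
    (hB : ∀ q < specialize p w (x + 1) + 1, q ∈ B ↔ q ∈ B') (h : Accepts p B m x) :
    Accepts p B' m x := by
  obtain ⟨c, hc, hx, h⟩ := h
  exact ⟨c, hc, hx, fun i hi => (h i hi).trans
    (hB _ (lt_succ_iff.2 (specialize_le (hc.le.trans hmw) hi.le)))⟩

/-- The inputs `x`, with all finite oracles and a bound for the necessary queries. -/
def finiteOracleFrame (p : M) [hE : ISig (∅ : Set M)] : Frame M where
  carrier := {y : M × M × M // SubsetBound (y.1 + 1) y.2.1}
  code := fun y => y.1.1
  O := fun y => {q | MemCode q y.1.2.2}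
  U := fun y => {q | q < specialize p y.1.2.1 (y.1.1 + 1) + 1}
  isig := fun y => ISig.of_bdd ∅ (by simp only [Set.mem_ofPred_eq]; infer_instance)
  bdd := fun y => by simp only [Set.mem_ofPred_eq]; infer_instance

/-- The program receives only `x` and finds the least bound by itself. The component `w` is not an
input; it only guarantees that the search ends by `w`, which limits the later queries. -/
theorem exists_cmp_subsetBound (p : M) [hE : ISig (∅ : Set M)] :
    ∃ m, (finiteOracleFrame p).Cmp m ∧ ∀ y, m y ≤ y.1.2.1 ∧ SubsetBound (y.1.1 + 1) (m y) := by
  have hx : (finiteOracleFrame p).Cmp fun y => y.1.1 := Frame.Cmp.code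
  have hsub : Bdd (∅ : Set M) (fun q : (PUnit.{u + 1} × M) × M =>
    ¬ SubsetBound (q.1.2 + 1) q.2) := by infer_instance
  let F₁ := (finiteOracleFrame p).ext fun y a => a ≤ y.1.2.1
  have hx₁ : F₁.Cmp fun y => y.1.1.1.1 := hx.fst
  have ha : F₁.Cmp fun y => y.1.2 := Frame.Cmp.snd
  have h1 := Frame.Dec.of_bdd hsub ((Frame.CmpMap.unit.prod hx₁).prod ha)
  obtain ⟨m, hm, h⟩ := Frame.Cmp.search (F := finiteOracleFrame p) (t := fun y => y.1.2.1)
    (G := fun y a => char M (¬ SubsetBound (y.1.1 + 1) a)) h1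
    fun y => ⟨y.1.2.1, le_rfl, char_eq_zero.2 (not_not.2 y.2)⟩
  exact ⟨m, hm, fun y => ⟨(h y).1, not_not.1 (char_eq_zero.1 (h y).2.1)⟩⟩

theorem dec_accepts (p : M) [hE : ISig (∅ : Set M)] {m : (finiteOracleFrame p).carrier → M}
    (hm : (finiteOracleFrame p).Cmp m) (hle : ∀ y, m y ≤ y.1.2.1) :
    (finiteOracleFrame p).Dec fun y =>
      Accepts p ((finiteOracleFrame p).O y) (m y) y.1.1 := by
  have hx : (finiteOracleFrame p).Cmp fun y => y.1.1 := Frame.Cmp.code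
  have hmem : Bdd (∅ : Set M) (fun q : (PUnit.{u + 1} × M) × M => MemCode q.1.2 q.2) := by
    infer_instance
  let F₁ := (finiteOracleFrame p).ext fun y a => a ≤ m y
  have hc : F₁.Cmp fun y => y.1.2 := Frame.Cmp.snd
  have hx₁ : F₁.Cmp fun y => y.1.1.1.1 := hx.fst
  have h1 : F₁.Dec fun y => MemCode y.1.1.1.1 y.1.2 :=
    .of_bdd hmem ((Frame.CmpMap.unit.prod hx₁).prod hc)
  let F₂ := F₁.ext fun y i => i ≤ y.1.1.1.1 + 1
  have hi : F₂.Cmp fun y => y.1.2 := Frame.Cmp.snd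
  have hc₂ : F₂.Cmp fun y => y.1.1.1.2 := hc.fst
  have h2 : F₂.Dec fun y => MemCode y.1.2 y.1.1.1.2 :=
    .of_bdd hmem ((Frame.CmpMap.unit.prod hi).prod hc₂)
  have h3 : F₂.Dec fun y => specialize p y.1.1.1.2 y.1.2 ∈ F₂.O y := by
    refine Frame.Dec.oracle (F := F₂) ((Frame.Cmp.const 3).pair ((Frame.Cmp.const p).pair
      ((Frame.Cmp.const 0).pair (hc₂.pair hi)))) fun y => ?_
    -- Bounded searches also evaluate at their endpoints `c = m y` and `i = x + 1`; the set of
    -- permitted queries is chosen to include these.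
    exact lt_succ_iff.2 (specialize_le (y.1.1.2.trans (hle y.1.1.1.1)) y.2)
  have h4 : F₁.Dec fun y => ∀ i, i < y.1.1.1.1 + 1 →
      (MemCode i y.1.2 ↔ specialize p y.1.2 i ∈ F₁.O y) :=
    Frame.Dec.ball (F := F₁) (t := fun y => y.1.1.1.1 + 1)
      (R := fun y i => MemCode i y.1.2 ↔ specialize p y.1.2 i ∈ F₁.O y)
      (hx₁.add (.const 1)) (h2.iff h3)
  exact Frame.Dec.bex (F := finiteOracleFrame p) (R := fun y c => MemCode y.1.1 c ∧
      ∀ i, i < y.1.1 + 1 → (MemCode i c ↔ specialize p c i ∈ (finiteOracleFrame p).O y)) hm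
    (h1.and h4)

theorem exists_accepts_program (p : M) [hE : ISig (∅ : Set M)] :
    ∃ e, ∀ x w z, SubsetBound (x + 1) w → ∃ m ≤ w, SubsetBound (x + 1) m ∧
      PhiUse {q | MemCode q z} {q | q < specialize p w (x + 1) + 1} e x
        (char M (Accepts p {q | MemCode q z} m x)) := by
  obtain ⟨m, hm, h⟩ := exists_cmp_subsetBound p
  obtain ⟨e, he⟩ := dec_accepts p hm fun y => (h y).1
  exact ⟨e, fun x w z hw => ⟨m ⟨(x, w, z), hw⟩, (h _).1, (h _).2, he ⟨(x, w, z), hw⟩⟩⟩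

/-- With the true jump as oracle the accepted codes are correct ones, and the subset bound
guarantees that some correct code lies below `m`. -/
theorem accepts_jump_iff {T : Set M} [hT : ISig T] {p : M}
    (hp : ∀ c i, (∃ y, Phi T p (pair c i) y) ↔ Forced T c i) {m x : M}
    (hm : SubsetBound (x + 1) m) : Accepts p (jump T) m x ↔ x ∈ forcedSet T := by
  simp only [Accepts, specialize_mem_jump, hp]
  constructor
  · rintro ⟨c, -, hxc, hc⟩
    exact ⟨c, hc, hxc⟩
  · intro hx
    obtain ⟨c, hcm, hc⟩ := exists_correct (T := T) hm
    exact ⟨c, hcm, (hc.mem_forcedSet (lt_succ_self x)).1 hx, hc⟩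

/-! ### The computable bound on stages. -/

/-- `s` bounds computations of the program `e` for a sufficiently large set of oracles. -/
def StageBound (p e x s : M) : Prop :=
  ∃ w < s, SubsetBound (x + 1) w ∧ ∃ v < s, SubsetBound (specialize p w (x + 1) + 1) v ∧
    ∀ z < v, ∃ d < s, ∃ y < s, MemCode (pair e (pair x y)) d ∧
      Closed {q | MemCode q z} {q | q < specialize p w (x + 1) + 1} d

theorem bdd_stageBound_aux (B : Set M) (p e : M) :
    Bdd B (fun t : ((((PUnit.{u + 1} × M) × M) × M) × M) × M =>
      MemCode (pair e (pair t.1.1.1.1.2 t.2)) t.1.2 ∧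
      Closed {q | MemCode q t.1.1.2} {q | q < specialize p t.1.1.1.2 (t.1.1.1.1.2 + 1) + 1}
        t.1.2) := by
  have := (Bdd.closed (C := B) (O := fun t : ((PUnit.{u + 1} × M) × M) × M => {q | MemCode q t.2})
      (V := fun t => {q | q < specialize p t.1.2 (t.1.1.2 + 1) + 1})
      (by simp only [Set.mem_ofPred_eq]; infer_instance)
      (by simp only [Set.mem_ofPred_eq]; infer_instance)).comp
        (fun t : ((((PUnit.{u + 1} × M) × M) × M) × M) × M => (t.1.1, t.1.2))
  infer_instance

instance Bdd.stageBound (B : Set M) (p e : M) {X : Type u} [Ctx M X] (f g : X → M) [hf : Tm f]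
    [hg : Tm g] : Bdd B (fun x => StageBound p e (f x) (g x)) := by
  have h : Bdd B (fun t : (PUnit.{u + 1} × M) × M => StageBound p e t.1.2 t.2) := by
    have := (bdd_stageBound_aux B p e).comp
      (fun t : (((((((PUnit.{u + 1} × M) × M) × M) × M) × M) × M) × M) =>
        (((((PUnit.unit, t.1.1.1.1.1.1.2), t.1.1.1.1.2), t.1.1.2), t.1.2), t.2))
    unfold StageBound
    infer_instance
  exact h.comp (fun x => ((PUnit.unit, f x), g x))

/-- The program halts with every coded finite oracle, so collection over all codes `z < v` bounds
the computations simultaneously, without reference to `T`. -/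
theorem exists_stageBound {p e : M} [hE : ISig (∅ : Set M)]
    (he : ∀ x w z, SubsetBound (x + 1) w → ∃ y,
      PhiUse {q | MemCode q z} {q | q < specialize p w (x + 1) + 1} e x y) (x : M) :
    ∃ s, StageBound p e x s := by
  obtain ⟨w, hw⟩ := exists_subsetBound ∅ (x + 1)
  obtain ⟨v, hv⟩ := exists_subsetBound ∅ (specialize p w (x + 1) + 1)
  have hb := (bdd_stageBound_aux ∅ p e).comp
    (fun t : ((PUnit.{u + 1} × M) × M) × M => (((((PUnit.unit, x), w), t.1.1.2), t.1.2), t.2))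
  obtain ⟨s, hs⟩ := ISig.collection ∅ (R := fun z a => ∃ d ≤ a, ∃ y ≤ a,
    MemCode (pair e (pair x y)) d ∧
      Closed {q | MemCode q z} {q | q < specialize p w (x + 1) + 1} d) (by
        have := hb.comp (fun t : (((PUnit.{u + 1} × M) × M) × M) × M =>
          (((PUnit.unit, t.1.1.1.2), t.1.2), t.2))
        infer_instance) v (by
    intro z _
    obtain ⟨y, d, h, hd⟩ := he x w z hw
    exact ⟨d, d, le_rfl, y, (entry_lt h).2.2.le, h, hd⟩)
  have h0 : s < max (max w v) s + 1 := lt_succ_iff.2 (le_max_right _ _)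
  refine ⟨max (max w v) s + 1, w, lt_succ_iff.2 ((le_max_left _ _).trans (le_max_left _ _)), hw,
    v, lt_succ_iff.2 ((le_max_right _ _).trans (le_max_left _ _)), hv, fun z hz => ?_⟩
  obtain ⟨a, ha, d, hd, y, hy, h⟩ := hs z hz
  exact ⟨d, (hd.trans ha).trans_lt h0, y, (hy.trans ha).trans_lt h0, h⟩

instance Sg.mem_jump (T : Set M) : Sg T (fun q : PUnit.{u + 1} × M => q.2 ∈ jump T) := by
  have := (Bdd.closed (C := T) (O := fun _ : PUnit.{u + 1} => T) (V := fun _ => Set.univ)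
    (by infer_instance) (by simp only [Set.mem_univ]; infer_instance)).comp
      (fun q : ((PUnit.{u + 1} × M) × M) × M => (PUnit.unit, q.2))
  refine (inferInstance : Sg T (fun q : PUnit.{u + 1} × M => ∃ y d,
    MemCode (pair q.2 (pair q.2 y)) d ∧ Closed T Set.univ d)).congr fun q => ?_
  exact exists_congr fun y => phi_iff

theorem wttReducible_forcedSet {T : Set M} [hT : ISig T] :
    WTTReducible (forcedSet T) (jump T) := by
  have := ISig.empty T
  obtain ⟨p, hp⟩ := exists_forced_program T
  obtain ⟨e, he⟩ := exists_accepts_program p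
  have hstage : ∀ x, ∃ s, StageBound p e x s ∧ ∀ s' < s, ¬ StageBound p e x s' := fun x =>
    ISig.exists_least ∅ (by infer_instance) (exists_stageBound (fun x w z hw => by
      obtain ⟨m, -, -, h⟩ := he x w z hw
      exact ⟨_, h⟩) x)
  choose f hf hmin using hstage
  -- Induction relative to `T'` is not assumed. But `T'` is `Σ₁` in `T`, so each bounded part of it
  -- is coded, and computations with oracle `T'` are obtained from those with the coded part.
  have approx : ∀ {u v : M}, SubsetBound u v → ∃ z < v, ∀ q < u, MemCode q z ↔ q ∈ jump T := by
    intro u v hv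
    obtain ⟨z, hz, h⟩ := exists_code T hv (R := fun q => q ∈ jump T) (by infer_instance)
    exact ⟨z, hz, fun q hq => (h q).trans (and_iff_right hq)⟩
  have hval : ∀ x, PhiUse (jump T) Set.univ e x (char M (x ∈ forcedSet T)) := by
    intro x
    obtain ⟨w, hw⟩ := exists_subsetBound T (x + 1)
    obtain ⟨v, hv⟩ := exists_subsetBound T (specialize p w (x + 1) + 1)
    obtain ⟨z, -, hz⟩ := approx hv
    obtain ⟨m, hmw, hm, h⟩ := he x w z hw
    have h1 : Accepts p {q | MemCode q z} m x ↔ x ∈ forcedSet T := by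
      rw [← accepts_jump_iff hp hm]
      exact ⟨Accepts.congr hmw hz, Accepts.congr hmw fun q hq => (hz q hq).symm⟩
    rw [show Accepts p {q | MemCode q z} m x = (x ∈ forcedSet T) from propext h1] at h
    exact phi_iff.1 (h.congr_oracle hz).phi
  refine ⟨e, f, ?_, fun x => ⟨fun hx => ?_, fun hx => ?_⟩, fun x => ?_⟩
  -- The bound `f x` is the least `s` with `StageBound p e x s`, a bounded condition without set
  -- parameter; hence `f` is computable.
  · have hg : {q | ∃ x, q = pair x (f x)} = {q | ∃ x s, q = pair x s ∧ StageBound p e x s ∧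
        ∀ s' < s, ¬ StageBound p e x s'} := by
      ext q
      refine exists_congr fun x => ⟨fun hq => ⟨f x, hq, hf x, hmin x⟩, ?_⟩
      rintro ⟨s, rfl, hs, hs'⟩
      rcases lt_trichotomy s (f x) with h | h | h
      · exact absurd hs (hmin x s h)
      · rw [h]
      · exact absurd (hf x) (hs' _ h)
    unfold ComputableFun
    rw [hg]
    exact Sg.sigmaOne (R := fun q => ∃ x s, q = pair x s ∧ StageBound p e x s ∧
      ∀ s' < s, ¬ StageBound p e x s') (by infer_instance)
  · have h := hval x
    rw [char_eq_one.2 hx] at h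
    exact h.phi
  · have h := hval x
    rw [char_eq_zero.2 hx] at h
    exact h.phi
  · obtain ⟨w, -, hw, v, -, hv, h⟩ := hf x
    -- Among the finite oracles covered by the stage bound is the one that agrees with `T'` on the
    -- permitted queries.
    obtain ⟨z, hzv, hz⟩ := approx hv
    obtain ⟨d, hd, y, -, h1, h2⟩ := h z hzv
    exact ⟨y, d, hd, (h2.congr_oracle hz).isComputation h1⟩

end Reduction

end RevRec

theorem mainTheorem6 {M : Type*} [CommSemiring M] [LinearOrder M] [RevRec.PMinus M]
    (A T : Set M) (hA : RevRec.ModelsExpISigmaOne A)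
    (hT : RevRec.IsBinaryTree T) (hTA : RevRec.DeltaOne A T) (hTinf : RevRec.IsInfinite T) :
    ∃ P : Set M, P ⊆ T ∧ RevRec.IsPath P ∧ RevRec.IsInfinite P ∧
      RevRec.WTTReducible (RevRec.jump P) (RevRec.jump T) := by
  have hAI : RevRec.ISig A := ⟨hA.induction⟩
  -- From here on `T` itself serves as the set parameter in place of `A`.
  have hTI : RevRec.ISig T := RevRec.ISig.of_delta A (hTA.1.sg A) (hTA.2.sg A)
  refine ⟨RevRec.forcedPath T, RevRec.forcedPath_subset hT hTinf,
    RevRec.isPath_forcedPath hT hTinf, RevRec.isInfinite_forcedPath hT hTinf, ?_⟩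
  rw [RevRec.jump_forcedPath hT hTinf]
  exact RevRec.wttReducible_forcedSet
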